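/- Let $A=\begin{pmatrix}0&1&1\\1&0&1\\1&1&1\end{pmatrix}$, let $\Sigma_A^+\subset\{1,2,3\}^{\mathbb N}$ be the one-sided subshift of finite type $\{x: A(x_i,x_{i+1})=1\ \forall i\ge 0\}$ with shift $T$ and cylinders $C[i_0\ldots i_m]_k=\{x: x_{k+j}=i_j,\ 0\le j\le m\}$ (written $C[i_0\ldots i_m]$ when $k=0$). For a real function $\phi$ on $\Sigma_A^+$ put $(\mathcal L_\phi\psi)(x)=\sum_{i:A(i,x_0)=1}e^{\phi(ix)}\psi(ix)$; $\phi$ is normalised if $\mathcal L_\phi 1=1$. The pressure $P(\phi)$ is the supremum of $h(m)+\int\phi\,dm$ over all $T$-invariant probabilities $m$ ($h$ the Kolmogorov–Sinai entropy), and an equilibrium state is an invariant probability attaining it. Let $\Delta=\{1,2\}$, $\Sigma_\Delta=\{x: x_i\in\Delta\ \forall i\}$, $\Delta_n=\{x: x_0,\ldots,x_{n-1}\in\Delta\}$, $\mathcal L_\Delta\psi=\mathcal L_\phi(\psi\chi_{\{x_0\in\Delta\}})$, and let $P_\Delta$ be the pressure of $\phi|_{\Sigma_\Delta}$ for $T|_{\Sigma_\Delta}$.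 The matrix $A$ is irreducible and aperiodic, its restriction $A_\Delta$ to $\Delta$ is irreducible of period $2$, and $\Sigma_\Delta=\{a,b\}$ with $a=(1,2,1,2,\ldots)$, $b=(2,1,2,1,\ldots)$, $Ta=b$, $Tb=a$. Let $p,q\in\mathbb R$. A normalised Hölder continuous $\phi$ with $\phi\equiv p$ on $C[1]$ and $\phi\equiv q$ on $C[2]$ exists if and only if $e^p+e^q<1$, and it is then unique. For this $\phi$: (1) $\phi|_{C[31]}\equiv\log(1-e^q)$, $\phi|_{C[32]}\equiv\log(1-e^p)$, $\phi|_{C[33]}\equiv\log(1-e^p-e^q)$. (2) $\frac12(\delta_a+\delta_b)$ is the only invariant probability of $T|_{\Sigma_\Delta}$; $P(\phi)=0$ and $P_\Delta=\frac12(p+q)$. (3) Put $\phi^{(2)}=\phi+\phi\circ T$, let $\mathcal L_{\phi^{(2)}}=\mathcal L_\phi^2$ be its transfer operator for $T^2$, and put $\mathcal L_{12}\psi=\mathcal L_{\phi^{(2)}}(\psi\chi_{C[12]})$, $\mathcal L_{21}\psi=\mathcal L_{\phi^{(2)}}(\psi\chi_{C[21]})$. Then, pointwise, $h_0:=\lim_n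 e^{-2nP_\Delta}\mathcal L_{12}^n1=\chi_{C[1]\cup C[3]}$ and $h_1:=\lim_n e^{-2nP_\Delta}\mathcal L_{21}^n1=\chi_{C[2]\cup C[3]}$. Moreover $\mathcal L_\Delta1(b)=e^p$, $\mathcal L_\Delta1(a)=e^q$, $\mathcal L_\Delta h_0=e^ph_1$, $\mathcal L_\Delta h_1=e^qh_0$. For every continuous $\psi:\Sigma_A^+\to\mathbb C$, uniformly on $\Sigma_A^+$ as $n\to\infty$, $$e^{-2nP_\Delta}\mathcal L_\Delta^{2n}\psi\to h_0\,\psi(a)+h_1\,\psi(b),\qquad e^{-(2n+1)P_\Delta}\mathcal L_\Delta^{2n+1}\psi\to e^{\frac12(p-q)}h_1\,\psi(a)+e^{\frac12(q-p)}h_0\,\psi(b).$$ (4) The matrix $$P=\begin{pmatrix}0&e^q&1-e^q\\e^p&0&1-e^p\\e^p&e^q&1-e^p-e^q\end{pmatrix}$$ is stochastic, with strictly positive stationary left eigenvector $$(p_1,p_2,p_3)=\Big(\frac{e^p}{1+e^p},\ \frac{e^q}{1+e^q},\ 1-\frac{e^p}{1+e^p}-\frac{e^q}{1+e^q}\Big).$$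 The potential $\phi$ has exactly one equilibrium state $\mu$. It is the Markov measure for which $P$ is the matrix of backward transition probabilities, that is, $$\mu(C[i_0\ldots i_m]_k)=p_{i_m}\prod_{r=0}^{m-1}P_{i_{r+1}i_r}\quad\text{for all } k,m\ge 0;$$ equivalently, it is the Markov measure with initial law $(p_i)$ and (forward) stochastic matrix $Q_{ij}=p_jP_{ji}/p_i$. (5) Along even and odd indices, $$\lim_{n\to\infty}e^{-2nP_\Delta}\mu(\Delta_{2n})=\int(h_0+h_1)\,d\mu=\frac{2+e^p+e^q}{(1+e^p)(1+e^q)},$$ $$\lim_{n\to\infty}e^{-(2n+1)P_\Delta}\mu(\Delta_{2n+1})=e^{\frac12(q-p)}\!\int h_0\,d\mu+e^{\frac12(p-q)}\!\int h_1\,d\mu=\frac{e^{\frac12(q-p)}(1+e^p)+e^{\frac12(p-q)}(1+e^q)}{(1+e^p)(1+e^q)}.$$ (6) These two limits are equal if and only if $p=q$. Hence $e^{-nP_\Delta}\mu(\Delta_n)$ converges as $n\to\infty$ if and only if $p=q$; in particular it does not converge when $p\ne q$. -/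

import Mathlib

open MeasureTheory Filter Topology

noncomputable section

/-! ### Measure-theoretic entropy, pressure, equilibrium states -/

/-- Shannon entropy `-∑ μ(ξ = i) log μ(ξ = i)` of a finite partition, the partition being
given by its labelling map `ξ`. -/
def partitionEntropy {X ι : Type*} [MeasurableSpace X] [Fintype ι]
    (μ : Measure X) (ξ : X → ι) : ℝ :=
  ∑ i, Real.negMulLog (μ.real (ξ ⁻¹' {i}))

/-- The labelling map of the joined partition `ξ ∨ T⁻¹ξ ∨ ⋯ ∨ T^{-(n-1)}ξ`. -/
def itinerary {X ι : Type*} (T : X → X) (ξ : X → ι) (n : ℕ) (x : X) : Fin n → ι :=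
  fun i => ξ (T^[i] x)

/-- Kolmogorov–Sinai entropy `h(μ)` of `T`: the supremum over all finite measurable partitions
`ξ` of the entropy `lim (1/n) H(ξ ∨ ⋯ ∨ T^{-(n-1)}ξ)` of `T` relative to `ξ`. -/
def ksEntropy {X : Type*} [MeasurableSpace X] (T : X → X) (μ : Measure X) : EReal :=
  ⨆ k : ℕ, ⨆ ξ : {ξ : X → Fin k // Measurable ξ},
    limsup (fun n : ℕ => ((partitionEntropy μ (itinerary T ξ.1 n) / n : ℝ) : EReal)) atTop

/-- The `T`-invariant probability measures. -/
def IsInvariantProb {X : Type*} [MeasurableSpace X] (T : X → X) (μ : Measure X) : Prop :=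
  IsProbabilityMeasure μ ∧ MeasurePreserving T μ μ

/-- The pressure of `φ`: the supremum of `h(m) + ∫ φ dm` over the invariant probabilities `m`. -/
def pressure {X : Type*} [MeasurableSpace X] (T : X → X) (φ : X → ℝ) : EReal :=
  ⨆ m : {m : Measure X // IsInvariantProb T m},
    ksEntropy T m.1 + ((∫ x, φ x ∂m.1 : ℝ) : EReal)

/-- Equilibrium states of `φ`: invariant probabilities attaining the pressure. -/
def IsEquilibriumState {X : Type*} [MeasurableSpace X] (T : X → X) (φ : X → ℝ)
    (μ : Measure X) : Prop :=
  IsInvariantProb T μ ∧ ksEntropy T μ + ((∫ x, φ x ∂μ : ℝ) : EReal) = pressure T φ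

/-! ### One-sided subshifts of finite type -/

/-- The space `Σ_A⁺` of allowed one-sided paths, with the topology and σ-algebra induced by the
product of the discrete ones. -/
abbrev SFT {ℓ : ℕ} (A : Matrix (Fin ℓ) (Fin ℓ) ℤ) : Type :=
  {x : ℕ → Fin ℓ // ∀ i, A (x i) (x (i + 1)) = 1}

section SFT

variable {ℓ : ℕ} {A : Matrix (Fin ℓ) (Fin ℓ) ℤ}

/-- The shift map. -/
def shift (x : SFT A) : SFT A := ⟨fun n => x.1 (n + 1), fun i => x.2 (i + 1)⟩

/-- The cylinder `C[w₀, …, w_m]_k`. -/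
def cyl (A : Matrix (Fin ℓ) (Fin ℓ) ℤ) (k : ℕ) {m : ℕ} (w : Fin (m + 1) → Fin ℓ) : Set (SFT A) :=
  {x | ∀ j : Fin (m + 1), x.1 (j + k) = w j}

/-- Hölder continuity: the `n`-th variation is at most `K θ ^ n` for some `0 < θ < 1`. -/
def IsHolder (φ : SFT A → ℝ) : Prop :=
  ∃ θ : ℝ, 0 < θ ∧ θ < 1 ∧ ∃ K : ℝ, ∀ (n : ℕ) (x y : SFT A),
    (∀ i ≤ n, x.1 i = y.1 i) → |φ x - φ y| ≤ K * θ ^ n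

/-- The point `i x₀ x₁ x₂ …`. -/
def cons (i : Fin ℓ) (x : SFT A) (h : A i (x.1 0) = 1) : SFT A :=
  ⟨fun n => Nat.casesOn n i x.1, fun n => by cases n with
    | zero => exact h
    | succ n => exact x.2 n⟩

/-- The transfer operator `(L_φ ψ)(x) = ∑_{i : A(i, x₀) = 1} e^{φ(ix)} ψ(ix)`. -/
def transfer {E : Type*} [AddCommMonoid E] [Module ℝ E] (φ : SFT A → ℝ) (ψ : SFT A → E) :
    SFT A → E :=
  fun x => ∑ i, if h : A i (x.1 0) = 1 then Real.exp (φ (cons i x h)) • ψ (cons i x h) else 0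

/-- `φ` is normalised if `L_φ 1 = 1`. -/
def IsNormalised (φ : SFT A → ℝ) : Prop := ∀ x, transfer φ (fun _ => (1 : ℝ)) x = 1

/-- The restricted transfer operator `L_Δ ψ = L_φ (ψ · χ_Δ)`. -/
def transferRestr {E : Type*} [AddCommMonoid E] [Module ℝ E] (φ : SFT A → ℝ)
    (Δ : Finset (Fin ℓ)) (ψ : SFT A → E) : SFT A → E :=
  transfer φ ({x : SFT A | x.1 0 ∈ Δ}.indicator ψ)

/-- For `φ⁽²⁾ = φ + φ ∘ T` and a word `ab`, the operator `ψ ↦ L_{φ⁽²⁾}(ψ · χ_{C[ab]})` of the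
map `T²`; here `L_{φ⁽²⁾} = L_φ ∘ L_φ`. -/
def transferWord (φ : SFT A → ℝ) (a b : Fin ℓ) (ψ : SFT A → ℝ) : SFT A → ℝ :=
  transfer φ (transfer φ ({x : SFT A | x.1 0 = a ∧ x.1 1 = b}.indicator ψ))

/-- The set `Δ_n` of points whose first `n` symbols lie in `Δ`. -/
def survivors (A : Matrix (Fin ℓ) (Fin ℓ) ℤ) (Δ : Finset (Fin ℓ)) (n : ℕ) : Set (SFT A) :=
  {x | ∀ i < n, x.1 i ∈ Δ}

/-- The subsystem `Σ_Δ` of points all of whose symbols lie in `Δ`. -/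
def subsystem (A : Matrix (Fin ℓ) (Fin ℓ) ℤ) (Δ : Finset (Fin ℓ)) : Set (SFT A) :=
  {x | ∀ i, x.1 i ∈ Δ}

/-- The shift restricted to `Σ_Δ`. -/
def subShift (A : Matrix (Fin ℓ) (Fin ℓ) ℤ) (Δ : Finset (Fin ℓ)) (x : subsystem A Δ) :
    subsystem A Δ :=
  ⟨shift x.1, fun i => x.2 (i + 1)⟩

/-- The pressure (as an extended real) of `φ` restricted to `Σ_Δ`. -/
def subPressure (φ : SFT A → ℝ) (Δ : Finset (Fin ℓ)) : EReal :=
  pressure (subShift A Δ) (fun x => φ x.1)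

/-- `μ` is the Markov measure with stochastic matrix `Q` and stationary initial distribution
`π`. -/
structure IsMarkovMeasure (μ : Measure (SFT A)) (π : Fin ℓ → ℝ)
    (Q : Matrix (Fin ℓ) (Fin ℓ) ℝ) : Prop where
  init_nonneg : ∀ i, 0 ≤ π i
  init_sum : ∑ i, π i = 1
  nonneg : ∀ i j, 0 ≤ Q i j
  row_sum : ∀ i, ∑ j, Q i j = 1
  stationary : Matrix.vecMul π Q = π
  measure_cyl : ∀ (m : ℕ) (w : Fin (m + 1) → Fin ℓ),
    μ.real (cyl A 0 w) = π (w 0) * ∏ r : Fin m, Q (w r.castSucc) (w r.succ)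

end SFT

/-! ### The example.  The symbols `1, 2, 3` are `0, 1, 2 : Fin 3`. -/

/-- The transition matrix. -/
def exA : Matrix (Fin 3) (Fin 3) ℤ := !![0, 1, 1; 1, 0, 1; 1, 1, 1]

/-- The sub-alphabet `{1, 2}`. -/
def exΔ : Finset (Fin 3) := {0, 1}

/-- The restriction of the transition matrix to the sub-alphabet. -/
def exAΔ : Matrix exΔ exΔ ℤ := exA.submatrix Subtype.val Subtype.val

/-- The point `(1, 2, 1, 2, …)`. -/
def pt12 : SFT exA :=
  ⟨fun n => if Even n then 0 else 1, fun n => by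
    by_cases h : Even n <;> simp [h, Nat.even_add_one, exA]⟩

/-- The point `(2, 1, 2, 1, …)`. -/
def pt21 : SFT exA :=
  ⟨fun n => if Even n then 1 else 0, fun n => by
    by_cases h : Even n <;> simp [h, Nat.even_add_one, exA]⟩

theorem pt12_mem : pt12 ∈ subsystem exA exΔ := fun n => by
  by_cases h : Even n <;> simp [pt12, exΔ, h]

theorem pt21_mem : pt21 ∈ subsystem exA exΔ := fun n => by
  by_cases h : Even n <;> simp [pt21, exΔ, h]

/-- The stochastic matrix `P`. -/
def exP (p q : ℝ) : Matrix (Fin 3) (Fin 3) ℝ :=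
  !![0, Real.exp q, 1 - Real.exp q;
     Real.exp p, 0, 1 - Real.exp p;
     Real.exp p, Real.exp q, 1 - Real.exp p - Real.exp q]

/-- The stationary vector `(p₁, p₂, p₃)`. -/
def exπ (p q : ℝ) : Fin 3 → ℝ :=
  ![Real.exp p / (1 + Real.exp p), Real.exp q / (1 + Real.exp q),
    1 - Real.exp p / (1 + Real.exp p) - Real.exp q / (1 + Real.exp q)]

/-- The time reversal of `P` with respect to its stationary vector. -/
def exQ (p q : ℝ) : Matrix (Fin 3) (Fin 3) ℝ :=
  Matrix.of fun i j => exπ p q j * exP p q j i / exπ p q i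

/-- `φ` is Hölder, normalised, equal to `p` on `C[1]` and to `q` on `C[2]`. -/
structure IsExPotential (p q : ℝ) (φ : SFT exA → ℝ) : Prop where
  holder : IsHolder φ
  normalised : IsNormalised φ
  eq_p : ∀ x, x.1 0 = 0 → φ x = p
  eq_q : ∀ x, x.1 0 = 1 → φ x = q

/-- The real number `P_Δ`. -/
def exPress (φ : SFT exA → ℝ) : ℝ := (subPressure φ exΔ).toReal

/-- The indicator function of `C[1] ∪ C[3]`. -/
def exh0 : SFT exA → ℝ := {x : SFT exA | x.1 0 = 0 ∨ x.1 0 = 2}.indicator 1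

/-- The indicator function of `C[2] ∪ C[3]`. -/
def exh1 : SFT exA → ℝ := {x : SFT exA | x.1 0 = 1 ∨ x.1 0 = 2}.indicator 1

end

/-!
The potential takes the value `φ(x) = log P(x₁, x₀)`, because normalisation at the points of each
cylinder `C[j]` leaves no choice on `C[3j]` (`IsExPotential.exp_apply_cons`). Everything else is
read off this formula.

*Transfer operators.* The restricted operator only prepends the symbols `1` and `2`, and these
have to alternate. Hence its even iterates evaluate `ψ` along `(12)ⁿx` and `(21)ⁿx`, weighted by
`h₀` and `h₁` (`IsExPotential.iterate_transferRestr_even`), and these points converge to `a` and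
`b` uniformly in `x`. The subsystem consists of the single orbit `{a, b}`, so it carries one
invariant probability, which has entropy zero.

*Equilibrium states.* Let `H_n` be the entropy of the partition into words of length `n`. The
Kolmogorov–Sinai entropy is at most every increment `H_{N+1} - H_N` (`ksEntropy_le_increment`):
the increments decrease by strong subadditivity, and an arbitrary finite partition has small
entropy given a long word, since its cells are approximated in measure by cylinder sets. For
`N ≥ 1` the sum `H_{N+1} - H_N + ∫ φ dm` equals minus the relative entropy of the law of `x₀ … x_N`
with respect to the law that keeps `x₁ … x_N` and draws `x₀` from `P(x₁, ·)`
(`IsExPotential.increment_add_integral_eq`). By Gibbs' inequality it is nonpositive, so the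
pressure is at most zero. If the free energy of `m` vanishes, then equality holds for every `N`,
so `m` is a Markov measure with backward transition matrix `P`; its one-dimensional law is
stationary for `P`, hence equal to `(p₁, p₂, p₃)`, and `m` is determined. Conversely, this Markov
measure exists by the Ionescu-Tulcea theorem (`exists_isMarkovMeasure`) and has free energy zero.

*Escape rates.* For `n ≥ 1` the set `Δ_n` is the union of two alternating cylinders, whose
measures are explicit (`real_survivors`). The two limits differ by a positive multiple of
`(u - v)² (1 - 1 / (u v))` with `u = e^{p/2}`, `v = e^{q/2}`, and `u v < 1`.
-/

noncomputable section

/-! ### Gibbs' inequality -/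

theorem mul_log_sub_log_le {a b : ℝ} (ha : 0 ≤ a) (hb : 0 ≤ b) (hab : b = 0 → a = 0) :
    a * (Real.log b - Real.log a) ≤ b - a := by
  rcases ha.eq_or_lt with rfl | ha'
  · simpa using hb
  have hb' : 0 < b := hb.lt_of_ne fun h => ha'.ne' (hab h.symm)
  rw [← Real.log_div hb'.ne' ha'.ne']
  have h := mul_le_mul_of_nonneg_left (Real.log_le_sub_one_of_pos (div_pos hb' ha')) ha
  have e : a * (b / a - 1) = b - a := by field_simp
  linarith

theorem eq_of_mul_log_sub_log_eq {a b : ℝ} (ha : 0 ≤ a) (hb : 0 ≤ b) (hab : b = 0 → a = 0)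
    (h : a * (Real.log b - Real.log a) = b - a) : a = b := by
  rcases ha.eq_or_lt with rfl | ha'
  · simpa [eq_comm] using h
  have hb' : 0 < b := hb.lt_of_ne fun h => ha'.ne' (hab h.symm)
  by_contra hne
  rw [← Real.log_div hb'.ne' ha'.ne'] at h
  have h1 : b / a ≠ 1 := fun h' => hne ((div_eq_one_iff_eq ha'.ne').1 h').symm
  have h2 := mul_lt_mul_of_pos_left (Real.log_lt_sub_one_of_pos (div_pos hb' ha') h1) ha'
  have e : a * (b / a - 1) = b - a := by field_simp
  linarith

/-- Gibbs' inequality for nonnegative vectors `a ≪ b`, not necessarily normalised. -/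
theorem sum_mul_log_sub_log_le {ι : Type*} [Fintype ι] {a b : ι → ℝ} (ha : ∀ i, 0 ≤ a i)
    (hb : ∀ i, 0 ≤ b i) (hab : ∀ i, b i = 0 → a i = 0) (hsum : ∑ i, b i ≤ ∑ i, a i) :
    ∑ i, a i * (Real.log (b i) - Real.log (a i)) ≤ 0 := by
  have := Finset.sum_le_sum fun i (_ : i ∈ Finset.univ) =>
    mul_log_sub_log_le (ha i) (hb i) (hab i)
  rw [Finset.sum_sub_distrib] at this
  linarith

/-- The equality case of Gibbs' inequality. -/
theorem eq_of_sum_mul_log_sub_log_nonneg {ι : Type*} [Fintype ι] {a b : ι → ℝ}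
    (ha : ∀ i, 0 ≤ a i) (hb : ∀ i, 0 ≤ b i) (hab : ∀ i, b i = 0 → a i = 0)
    (hsum : ∑ i, b i ≤ ∑ i, a i)
    (h : 0 ≤ ∑ i, a i * (Real.log (b i) - Real.log (a i))) (i : ι) : a i = b i := by
  have hle := fun i (_ : i ∈ Finset.univ) => mul_log_sub_log_le (ha i) (hb i) (hab i)
  have h1 := Finset.sum_le_sum hle
  have h2 : ∑ i, (b i - a i) ≤ 0 := by rw [Finset.sum_sub_distrib]; linarith
  have h3 := (Finset.sum_eq_sum_iff_of_le hle).1 (le_antisymm h1 (h2.trans h)) i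
    (Finset.mem_univ i)
  exact eq_of_mul_log_sub_log_eq (ha i) (hb i) (hab i) h3

/-! ### Entropy of finite partitions -/

section Partition

variable {X ι κ τ σ : Type*} [MeasurableSpace X] {μ : Measure X}
  [Fintype ι] [MeasurableSpace ι] [MeasurableSingletonClass ι]
  [MeasurableSpace κ] [MeasurableSingletonClass κ]
  [Fintype τ] [MeasurableSpace τ] [MeasurableSingletonClass τ]
  [Fintype σ] [MeasurableSpace σ] [MeasurableSingletonClass σ]

theorem sum_real_inter_preimage [IsFiniteMeasure μ] {ξ : X → ι} (hξ : Measurable ξ) {s : Set X}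
    (hs : MeasurableSet s) : ∑ i, μ.real (s ∩ ξ ⁻¹' {i}) = μ.real s := by
  classical
  rw [← measureReal_biUnion_finset]
  · congr 1; ext x; simp
  · intro i _ j _ hij
    refine Set.disjoint_left.2 fun x hx hy => hij ?_
    exact hx.2.symm.trans hy.2
  · exact fun i _ => hs.inter (hξ (measurableSet_singleton i))

theorem sum_real_prod_fst [IsFiniteMeasure μ] {ξ : X → ι} (hξ : Measurable ξ) {η : X → κ}
    (hη : Measurable η) (j : κ) :
    ∑ i, μ.real ((fun x => (ξ x, η x)) ⁻¹' {(i, j)}) = μ.real (η ⁻¹' {j}) := by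
  rw [← sum_real_inter_preimage hξ (hη (measurableSet_singleton j))]
  refine Finset.sum_congr rfl fun i _ => ?_
  congr 1; ext x; simp [and_comm]

variable [Fintype κ]

/-- A coarser partition has smaller entropy. -/
theorem partitionEntropy_le_of_factorsThrough [IsFiniteMeasure μ] {ξ : X → ι}
    (hξ : Measurable ξ) {η : X → κ} (hη : Measurable η) (h : ∀ x y, ξ x = ξ y → η x = η y) :
    partitionEntropy μ η ≤ partitionEntropy μ ξ := by
  classical
  set P : ι × κ → ℝ := fun c => μ.real ((fun x => (ξ x, η x)) ⁻¹' {c}) with hP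
  have h1 : ∀ j, μ.real (η ⁻¹' {j}) = ∑ i, P (i, j) := fun j => (sum_real_prod_fst hξ hη j).symm
  have h2 : ∀ i, μ.real (ξ ⁻¹' {i}) = ∑ j, P (i, j) := fun i => by
    rw [← sum_real_inter_preimage hη (hξ (measurableSet_singleton i))]
    refine Finset.sum_congr rfl fun j _ => ?_
    simp only [hP]; congr 1; ext x; simp
  -- a cell of `ξ` lies in one cell of `η`
  have h3 : ∀ i j, P (i, j) ≠ 0 → μ.real (ξ ⁻¹' {i}) = P (i, j) := by
    intro i j hij
    rw [h2]
    refine Finset.sum_eq_single_of_mem j (Finset.mem_univ j) fun j' _ hj' => ?_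
    by_contra hne
    obtain ⟨x, hx⟩ : ((fun x => (ξ x, η x)) ⁻¹' {(i, j)}).Nonempty := by
      rw [Set.nonempty_iff_ne_empty]; intro he; simp [hP, he] at hij
    obtain ⟨y, hy⟩ : ((fun x => (ξ x, η x)) ⁻¹' {(i, j')}).Nonempty := by
      rw [Set.nonempty_iff_ne_empty]; intro he; simp [hP, he] at hne
    simp only [Set.mem_preimage, Set.mem_singleton_iff, Prod.mk.injEq] at hx hy
    exact hj' (hy.2.symm.trans ((h y x (hy.1.trans hx.1.symm)).trans hx.2))
  have hP0 : ∀ c, 0 ≤ P c := fun c => measureReal_nonneg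
  unfold partitionEntropy
  have e1 : ∀ j, Real.negMulLog (μ.real (η ⁻¹' {j}))
      = ∑ i, -(P (i, j) * Real.log (μ.real (η ⁻¹' {j}))) := fun j => by
    rw [Finset.sum_neg_distrib, ← Finset.sum_mul, ← h1, Real.negMulLog, neg_mul]
  have e2 : ∀ i, Real.negMulLog (μ.real (ξ ⁻¹' {i}))
      = ∑ j, -(P (i, j) * Real.log (μ.real (ξ ⁻¹' {i}))) := fun i => by
    rw [Finset.sum_neg_distrib, ← Finset.sum_mul, ← h2, Real.negMulLog, neg_mul]
  rw [Finset.sum_congr rfl fun j _ => e1 j, Finset.sum_congr rfl fun i _ => e2 i,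
    Finset.sum_comm]
  refine Finset.sum_le_sum fun i _ => Finset.sum_le_sum fun j _ => ?_
  rcases eq_or_ne (P (i, j)) 0 with h0 | h0
  · simp [h0]
  rw [h3 i j h0, neg_le_neg_iff]
  have hpos : 0 < P (i, j) := (hP0 _).lt_of_ne h0.symm
  refine mul_le_mul_of_nonneg_left (Real.log_le_log hpos ?_) hpos.le
  rw [h1]
  exact Finset.single_le_sum (f := fun i => P (i, j)) (fun i _ => hP0 _) (Finset.mem_univ i)

theorem partitionEntropy_congr [IsFiniteMeasure μ] {ξ : X → ι}
    (hξ : Measurable ξ) {η : X → κ} (hη : Measurable η) (h : ∀ x y, ξ x = ξ y ↔ η x = η y) :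
    partitionEntropy μ ξ = partitionEntropy μ η :=
  le_antisymm (partitionEntropy_le_of_factorsThrough hη hξ fun x y => (h x y).2)
    (partitionEntropy_le_of_factorsThrough hξ hη fun x y => (h x y).1)

theorem partitionEntropy_comp {T : X → X} (hT : MeasurePreserving T μ μ) {ξ : X → ι}
    (hξ : Measurable ξ) : partitionEntropy μ (fun x => ξ (T x)) = partitionEntropy μ ξ := by
  unfold partitionEntropy
  refine Finset.sum_congr rfl fun i _ => ?_
  congr 1
  exact hT.measureReal_preimage (hξ (measurableSet_singleton i)).nullMeasurableSet

/-- Strong subadditivity of the Shannon entropy. -/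
theorem partitionEntropy_submodular [IsFiniteMeasure μ] {ξ : X → ι} (hξ : Measurable ξ)
    {η : X → κ} (hη : Measurable η) {ζ : X → τ} (hζ : Measurable ζ) :
    partitionEntropy μ (fun x => (ξ x, η x, ζ x)) + partitionEntropy μ ζ ≤
      partitionEntropy μ (fun x => (ξ x, ζ x)) + partitionEntropy μ (fun x => (η x, ζ x)) := by
  set P : ι × κ × τ → ℝ := fun c => μ.real ((fun x => (ξ x, η x, ζ x)) ⁻¹' {c}) with hP
  set R : ι × τ → ℝ := fun c => μ.real ((fun x => (ξ x, ζ x)) ⁻¹' {c}) with hR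
  set S : κ × τ → ℝ := fun c => μ.real ((fun x => (η x, ζ x)) ⁻¹' {c}) with hS
  set Z : τ → ℝ := fun c => μ.real (ζ ⁻¹' {c}) with hZ
  have hSP : ∀ b c, S (b, c) = ∑ a, P (a, b, c) := fun b c =>
    (sum_real_prod_fst hξ (hη.prodMk hζ) (b, c)).symm
  have hRP : ∀ a c, R (a, c) = ∑ b, P (a, b, c) := fun a c => by
    change μ.real ((fun x => (ξ x, ζ x)) ⁻¹' {(a, c)}) = _
    rw [← sum_real_prod_fst hη (hξ.prodMk hζ) (a, c)]
    refine Finset.sum_congr rfl fun b _ => ?_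
    simp only [hP]; congr 1; ext x; simp; tauto
  have hZR : ∀ c, Z c = ∑ a, R (a, c) := fun c => (sum_real_prod_fst hξ hζ c).symm
  have hZS : ∀ c, Z c = ∑ b, S (b, c) := fun c => (sum_real_prod_fst hη hζ c).symm
  have hP0 : ∀ c, 0 ≤ P c := fun c => measureReal_nonneg
  have hR0 : ∀ c, 0 ≤ R c := fun c => measureReal_nonneg
  have hS0 : ∀ c, 0 ≤ S c := fun c => measureReal_nonneg
  have hZ0 : ∀ c, 0 ≤ Z c := fun c => measureReal_nonneg
  have leR : ∀ a b c, P (a, b, c) ≤ R (a, c) := fun a b c => by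
    rw [hRP]; exact Finset.single_le_sum (f := fun b => P (a, b, c)) (fun b _ => hP0 _)
      (Finset.mem_univ b)
  have leS : ∀ a b c, P (a, b, c) ≤ S (b, c) := fun a b c => by
    rw [hSP]; exact Finset.single_le_sum (f := fun a => P (a, b, c)) (fun b _ => hP0 _)
      (Finset.mem_univ a)
  have leZ : ∀ a c, R (a, c) ≤ Z c := fun a c => by
    rw [hZR]; exact Finset.single_le_sum (f := fun a => R (a, c)) (fun b _ => hR0 _)
      (Finset.mem_univ a)
  -- Gibbs' inequality against the law making `ξ` and `η` conditionally independent given `ζ`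
  have key := sum_mul_log_sub_log_le (a := P) (b := fun t => R (t.1, t.2.2) * S t.2 / Z t.2.2) hP0
    (fun t => div_nonneg (mul_nonneg (hR0 _) (hS0 _)) (hZ0 _)) (by
      rintro ⟨a, b, c⟩ h
      simp only [div_eq_zero_iff, mul_eq_zero] at h
      refine le_antisymm ?_ (hP0 _)
      rcases h with (h | h) | h
      · exact h ▸ leR a b c
      · exact h ▸ leS a b c
      · exact h ▸ (leR a b c).trans (leZ a c)) (by
      refine le_of_eq ?_
      rw [Fintype.sum_prod_type_right, Fintype.sum_prod_type_right (f := P)]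
      refine Finset.sum_congr rfl fun ⟨b, c⟩ _ => ?_
      dsimp only
      rw [← hSP, ← Finset.sum_div, ← Finset.sum_mul, ← hZR]
      rcases eq_or_ne (Z c) 0 with h | h
      · have : S (b, c) = 0 := le_antisymm (h ▸ by
          rw [hZS]; exact Finset.single_le_sum (f := fun b => S (b, c)) (fun b _ => hS0 _)
            (Finset.mem_univ b)) (hS0 _)
        simp [h, this]
      · field_simp)
  have expand : ∀ t : ι × κ × τ, P t * (Real.log (R (t.1, t.2.2) * S t.2 / Z t.2.2)
      - Real.log (P t)) = P t * Real.log (R (t.1, t.2.2)) + P t * Real.log (S t.2)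
        - P t * Real.log (Z t.2.2) + Real.negMulLog (P t) := by
    rintro ⟨a, b, c⟩
    rcases (hP0 (a, b, c)).eq_or_lt with h | h
    · simp [← h]
    have hr := h.trans_le (leR a b c)
    have hs := h.trans_le (leS a b c)
    have hz := hr.trans_le (leZ a c)
    rw [Real.log_div (mul_pos hr hs).ne' hz.ne', Real.log_mul hr.ne' hs.ne', Real.negMulLog]
    ring
  rw [Finset.sum_congr rfl fun t _ => expand t, Finset.sum_add_distrib, Finset.sum_sub_distrib,
    Finset.sum_add_distrib] at key
  have eS : ∑ t : ι × κ × τ, P t * Real.log (S t.2) = - ∑ c, Real.negMulLog (S c) := by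
    rw [Fintype.sum_prod_type, Finset.sum_comm, ← Finset.sum_neg_distrib]
    refine Finset.sum_congr rfl fun c _ => ?_
    dsimp only
    rw [← Finset.sum_mul, Real.negMulLog, ← hSP c.1 c.2]; ring
  have eR : ∑ t : ι × κ × τ, P t * Real.log (R (t.1, t.2.2)) = - ∑ c, Real.negMulLog (R c) := by
    simp only [Fintype.sum_prod_type, ← Finset.sum_neg_distrib]
    refine Finset.sum_congr rfl fun a _ => ?_
    rw [Finset.sum_comm]
    refine Finset.sum_congr rfl fun c _ => ?_
    rw [← Finset.sum_mul, Real.negMulLog, ← hRP a c]; ring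
  have eZ : ∑ t : ι × κ × τ, P t * Real.log (Z t.2.2) = - ∑ c, Real.negMulLog (Z c) := by
    rw [Fintype.sum_prod_type, Finset.sum_comm, Fintype.sum_prod_type, Finset.sum_comm,
      ← Finset.sum_neg_distrib]
    refine Finset.sum_congr rfl fun c _ => ?_
    simp only [← Finset.sum_mul, ← hSP]
    rw [← hZS, Real.negMulLog]; ring
  rw [eS, eR, eZ] at key
  unfold partitionEntropy
  simp only [hP, hR, hS, hZ] at key
  linarith

variable (μ) in
/-- The conditional entropy `H(ξ | η) = H(ξ ∨ η) - H(η)` of two finite partitions. -/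
def condPartitionEntropy (ξ : X → ι) (η : X → κ) : ℝ :=
  partitionEntropy μ (fun x => (ξ x, η x)) - partitionEntropy μ η

theorem condPartitionEntropy_comp {T : X → X} (hT : MeasurePreserving T μ μ) {ξ : X → ι}
    (hξ : Measurable ξ) {η : X → κ} (hη : Measurable η) :
    condPartitionEntropy μ (fun x => ξ (T x)) (fun x => η (T x)) = condPartitionEntropy μ ξ η := by
  rw [condPartitionEntropy, condPartitionEntropy, partitionEntropy_comp hT hη,
    ← partitionEntropy_comp hT (hξ.prodMk hη)]

/-- Conditioning on a finer partition decreases the entropy. -/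
theorem condPartitionEntropy_anti [IsFiniteMeasure μ] {ξ : X → ι} (hξ : Measurable ξ)
    {η : X → κ} (hη : Measurable η) {ζ : X → τ} (hζ : Measurable ζ)
    (h : ∀ x y, η x = η y → ζ x = ζ y) :
    condPartitionEntropy μ ξ η ≤ condPartitionEntropy μ ξ ζ := by
  have h1 := partitionEntropy_submodular (μ := μ) hξ hη hζ
  have h2 : partitionEntropy μ (fun x => (ξ x, η x, ζ x))
      = partitionEntropy μ (fun x => (ξ x, η x)) :=
    partitionEntropy_congr (hξ.prodMk (hη.prodMk hζ)) (hξ.prodMk hη) fun x y => by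
      simp only [Prod.mk.injEq]; have := h x y; tauto
  have h3 : partitionEntropy μ (fun x => (η x, ζ x)) = partitionEntropy μ η :=
    partitionEntropy_congr (hη.prodMk hζ) hη fun x y => by
      simp only [Prod.mk.injEq]; have := h x y; tauto
  unfold condPartitionEntropy
  linarith

theorem condPartitionEntropy_congr [IsFiniteMeasure μ] {ξ : X → ι} (hξ : Measurable ξ)
    {ξ' : X → σ} (hξ' : Measurable ξ') {η : X → κ} (hη : Measurable η) {η' : X → τ}
    (hη' : Measurable η') (h : ∀ x y, η x = η y ↔ η' x = η' y)
    (h' : ∀ x y, η x = η y → (ξ x = ξ y ↔ ξ' x = ξ' y)) :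
    condPartitionEntropy μ ξ η = condPartitionEntropy μ ξ' η' := by
  unfold condPartitionEntropy
  rw [partitionEntropy_congr hη hη' h, partitionEntropy_congr (hξ.prodMk hη) (hξ'.prodMk hη')]
  intro x y
  simp only [Prod.mk.injEq]; have := h x y; have := h' x y; tauto

/-- Subadditivity of the conditional entropy in the first argument. -/
theorem condPartitionEntropy_prod_le [IsFiniteMeasure μ] {ξ : X → ι} (hξ : Measurable ξ)
    {η : X → κ} (hη : Measurable η) {ζ : X → τ} (hζ : Measurable ζ) :
    condPartitionEntropy μ (fun x => (ξ x, η x)) ζ ≤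
      condPartitionEntropy μ ξ ζ + condPartitionEntropy μ η ζ := by
  have h1 := partitionEntropy_submodular (μ := μ) hξ hη hζ
  have h2 : partitionEntropy μ (fun x => (ξ x, η x, ζ x))
      = partitionEntropy μ (fun x => ((ξ x, η x), ζ x)) :=
    partitionEntropy_congr (hξ.prodMk (hη.prodMk hζ)) ((hξ.prodMk hη).prodMk hζ) fun x y => by
      simp only [Prod.mk.injEq]; tauto
  unfold condPartitionEntropy
  linarith

/-- The function `-t log t` vanishes at `0` and `1`; here is the modulus of continuity at these two
points that makes conditional entropy small when a cell is almost decided. -/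
theorem negMulLog_le_add_abs_sub_div {t δ c : ℝ} (ht0 : 0 ≤ t) (hδ : 0 < δ) (hδ1 : δ ≤ 1)
    (hc : c = 0 ∨ c = 1) : Real.negMulLog t ≤ δ + |t - c| / δ := by
  rcases hc with rfl | rfl
  · rw [sub_zero, abs_of_nonneg ht0]
    rcases ht0.eq_or_lt with rfl | ht
    · simpa using hδ.le
    -- `-t log t = 2 t log (1 / √t) ≤ 2 √t ≤ δ + t / δ`
    have hs : 0 < √t := Real.sqrt_pos.2 ht
    have hst : √t * √t = t := Real.mul_self_sqrt ht0
    have h1 := Real.one_sub_inv_le_log_of_pos hs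
    have h2 : Real.log t = 2 * Real.log (√t) := by
      conv_lhs => rw [← hst]
      rw [Real.log_mul hs.ne' hs.ne']; ring
    have h3 : Real.negMulLog t ≤ 2 * √t := by
      rw [Real.negMulLog, h2]
      have : t * (√t)⁻¹ = √t := by
        rw [← div_eq_mul_inv, div_eq_iff hs.ne', hst]
      nlinarith [mul_le_mul_of_nonneg_left h1 ht0]
    have h4 : 2 * √t ≤ δ + t / δ := by
      rw [← sub_nonneg]
      have : δ + t / δ - 2 * √t = (δ - √t) ^ 2 / δ := by
        field_simp
        nlinarith
      rw [this]; positivity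
    linarith
  · have h1 := Real.negMulLog_le_one_sub_self ht0
    have h2 : |t - 1| ≤ |t - 1| / δ := by
      rw [le_div_iff₀ hδ]; nlinarith [abs_nonneg (t - 1)]
    have := neg_abs_le (t - 1)
    linarith

/-- The conditional entropy as an average over the cells of `η`; null cells contribute nothing,
whatever the value of the quotient there. -/
theorem condPartitionEntropy_eq [IsFiniteMeasure μ] {ξ : X → ι} (hξ : Measurable ξ)
    {η : X → κ} (hη : Measurable η) :
    condPartitionEntropy μ ξ η = ∑ i, ∑ j, μ.real (η ⁻¹' {j}) *
      Real.negMulLog (μ.real ((fun x => (ξ x, η x)) ⁻¹' {(i, j)}) / μ.real (η ⁻¹' {j})) := by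
  unfold condPartitionEntropy partitionEntropy
  rw [Fintype.sum_prod_type, Finset.sum_comm, ← Finset.sum_sub_distrib, Finset.sum_comm]
  refine Finset.sum_congr rfl fun j _ => ?_
  set M := μ.real (η ⁻¹' {j}) with hM
  have hsum := sum_real_prod_fst (μ := μ) hξ hη j
  have e : Real.negMulLog M = ∑ i, -(μ.real ((fun x => (ξ x, η x)) ⁻¹' {(i, j)}) * Real.log M) := by
    rw [Finset.sum_neg_distrib, ← Finset.sum_mul, hsum, Real.negMulLog, neg_mul]
  rw [e, ← Finset.sum_sub_distrib]
  refine Finset.sum_congr rfl fun i _ => ?_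
  set m := μ.real ((fun x => (ξ x, η x)) ⁻¹' {(i, j)}) with hm
  have hm0 : 0 ≤ m := measureReal_nonneg
  have hmM : m ≤ M := by
    rw [hM, ← hsum]
    exact Finset.single_le_sum (f := fun i => μ.real ((fun x => (ξ x, η x)) ⁻¹' {(i, j)}))
      (fun b _ => measureReal_nonneg) (Finset.mem_univ i)
  rcases hm0.eq_or_lt with h | h
  · simp [← h]
  have hM0 := h.trans_le hmM
  rw [Real.negMulLog, Real.negMulLog, Real.log_div h.ne' hM0.ne']
  field_simp
  ring

/-- If every cell of `ξ` is close in measure to a union of cells of `η`, the conditional entropy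
`H(ξ | η)` is small. -/
theorem condPartitionEntropy_le_of_symmDiff [IsProbabilityMeasure μ] {ξ : X → ι}
    (hξ : Measurable ξ) {η : X → κ} (hη : Measurable η) {δ ε : ℝ} (hδ : 0 < δ) (hδ1 : δ ≤ 1)
    (S : ι → Set κ) (hS : ∀ i, μ.real (symmDiff (η ⁻¹' S i) (ξ ⁻¹' {i})) ≤ ε) :
    condPartitionEntropy μ ξ η ≤ Fintype.card ι * (δ + ε / δ) := by
  classical
  rw [condPartitionEntropy_eq hξ hη, ← nsmul_eq_mul, ← Finset.card_univ, ← Finset.sum_const]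
  refine Finset.sum_le_sum fun i _ => ?_
  set B := ξ ⁻¹' {i} with hB
  have hBm : MeasurableSet B := hξ (measurableSet_singleton i)
  have hCm : MeasurableSet (η ⁻¹' S i) := hη (Set.toFinite _).measurableSet
  have hM1 : ∑ j, μ.real (η ⁻¹' {j}) = 1 := by
    have := sum_real_inter_preimage (μ := μ) hη MeasurableSet.univ
    simpa using this
  have step : ∀ j, μ.real (η ⁻¹' {j}) *
      Real.negMulLog (μ.real ((fun x => (ξ x, η x)) ⁻¹' {(i, j)}) / μ.real (η ⁻¹' {j})) ≤
      μ.real (η ⁻¹' {j}) * δ +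
        μ.real (symmDiff (η ⁻¹' S i) B ∩ η ⁻¹' {j}) / δ := by
    intro j
    have hpre : (fun x => (ξ x, η x)) ⁻¹' {(i, j)} = B ∩ η ⁻¹' {j} := by
      ext x; simp [hB]
    rw [hpre]
    set M := μ.real (η ⁻¹' {j}) with hM
    have hM0 : 0 ≤ M := measureReal_nonneg
    rcases hM0.eq_or_lt with h | h
    · rw [← h]; simp; positivity
    -- `c` is the constant value on the cell of the indicator that approximates `B`
    set c : ℝ := if j ∈ S i then 1 else 0 with hc
    have h1 := negMulLog_le_add_abs_sub_div (t := μ.real (B ∩ η ⁻¹' {j}) / M)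
      (div_nonneg measureReal_nonneg hM0) hδ hδ1 (c := c)
      (by by_cases hj : j ∈ S i <;> simp [hc, hj])
    have h2 : |μ.real (B ∩ η ⁻¹' {j}) / M - c| * M ≤
        μ.real (symmDiff (η ⁻¹' S i) B ∩ η ⁻¹' {j}) := by
      rw [← abs_of_pos h, ← abs_mul, abs_of_pos h, sub_mul, div_mul_cancel₀ _ h.ne']
      by_cases hj : j ∈ S i
      · have e1 : symmDiff (η ⁻¹' S i) B ∩ η ⁻¹' {j} = η ⁻¹' {j} \ B := by
          ext x
          simp only [Set.mem_inter_iff, Set.mem_symmDiff, Set.mem_preimage,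
            Set.mem_singleton_iff, Set.mem_sdiff]
          constructor
          · rintro ⟨hx | hx, rfl⟩
            · exact ⟨rfl, hx.2⟩
            · exact absurd hj hx.2
          · rintro ⟨rfl, hx⟩; exact ⟨Or.inl ⟨hj, hx⟩, rfl⟩
        have e2 := measureReal_inter_add_sdiff (μ := μ) (s := η ⁻¹' {j}) hBm
        rw [Set.inter_comm, ← hM] at e2
        have e3 : 0 ≤ μ.real (η ⁻¹' {j} \ B) := measureReal_nonneg
        rw [e1, hc, if_pos hj, one_mul, abs_sub_comm, abs_of_nonneg] <;> linarith
      · rw [hc, if_neg hj, zero_mul, sub_zero, abs_of_nonneg measureReal_nonneg]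
        refine measureReal_mono ?_
        rintro x ⟨hx, rfl⟩
        exact ⟨Or.inr ⟨hx, hj⟩, rfl⟩
    calc M * Real.negMulLog (μ.real (B ∩ η ⁻¹' {j}) / M)
        ≤ M * (δ + |μ.real (B ∩ η ⁻¹' {j}) / M - c| / δ) := mul_le_mul_of_nonneg_left h1 hM0
      _ = M * δ + (|μ.real (B ∩ η ⁻¹' {j}) / M - c| * M) / δ := by ring
      _ ≤ _ := by gcongr
  refine (Finset.sum_le_sum fun j _ => step j).trans ?_
  rw [Finset.sum_add_distrib, ← Finset.sum_mul, ← Finset.sum_div, hM1,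
    sum_real_inter_preimage hη (hCm.symmDiff hBm), one_mul]
  have := hS i
  gcongr

end Partition

/-! ### Cylinders of a subshift and Kolmogorov–Sinai entropy -/

section Subshift

variable {ℓ : ℕ} {A : Matrix (Fin ℓ) (Fin ℓ) ℤ}

/-- The word `x₀ … x_{n-1}`. -/
def prefixWord (n : ℕ) (x : SFT A) : Fin n → Fin ℓ := fun i => x.1 i

theorem iterate_shift_apply (k n : ℕ) (x : SFT A) : (shift^[k] x).1 n = x.1 (n + k) := by
  induction k generalizing x with
  | zero => rfl
  | succ k ih => rw [Function.iterate_succ_apply, ih]; exact congrArg x.1 (by omega)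

theorem measurable_coord (n : ℕ) : Measurable fun x : SFT A => x.1 n :=
  (measurable_pi_apply n).comp measurable_subtype_coe

theorem measurable_shift : Measurable (shift : SFT A → SFT A) :=
  Measurable.subtype_mk (measurable_pi_lambda _ fun n => measurable_coord (n + 1))

theorem measurable_prefixWord (n : ℕ) : Measurable (prefixWord n : SFT A → _) :=
  measurable_pi_lambda _ fun i => measurable_coord i

theorem prefixWord_eq_iff {n : ℕ} {x y : SFT A} :
    prefixWord n x = prefixWord n y ↔ ∀ i < n, x.1 i = y.1 i :=
  ⟨fun h i hi => congrFun h ⟨i, hi⟩, fun h => funext fun i => h i i.2⟩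

theorem prefixWord_eq_of_le {n N : ℕ} (h : n ≤ N) {x y : SFT A}
    (hxy : prefixWord N x = prefixWord N y) : prefixWord n x = prefixWord n y :=
  prefixWord_eq_iff.2 fun i hi => prefixWord_eq_iff.1 hxy i (hi.trans_le h)

theorem prefixWord_succ_eq_iff {n : ℕ} {x y : SFT A} :
    prefixWord (n + 1) x = prefixWord (n + 1) y ↔
      x.1 0 = y.1 0 ∧ prefixWord n (shift x) = prefixWord n (shift y) := by
  simp only [prefixWord_eq_iff, shift]
  refine ⟨fun h => ⟨h 0 (by omega), fun i hi => h (i + 1) (by omega)⟩, fun h i hi => ?_⟩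
  cases i with
  | zero => exact h.1
  | succ i => exact h.2 i (by omega)

theorem prefixWord_preimage_lift {n N : ℕ} (h : n ≤ N) (S : Set (Fin n → Fin ℓ)) :
    ∃ S' : Set (Fin N → Fin ℓ), (prefixWord n ⁻¹' S : Set (SFT A)) = prefixWord N ⁻¹' S' :=
  ⟨{w | (fun i : Fin n => w (Fin.castLE h i)) ∈ S}, rfl⟩

variable (A) in
/-- The ring of the sets that depend on finitely many coordinates. -/
def cylinderRing : Set (Set (SFT A)) := {s | ∃ n, ∃ S : Set (Fin n → Fin ℓ), s = prefixWord n ⁻¹' S}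

theorem isSetRing_cylinderRing : IsSetRing (cylinderRing A) where
  empty_mem := ⟨0, ∅, rfl⟩
  union_mem := by
    rintro _ _ ⟨n, S, rfl⟩ ⟨m, R, rfl⟩
    obtain ⟨S', hS⟩ := prefixWord_preimage_lift (A := A) (le_max_left n m) S
    obtain ⟨R', hR⟩ := prefixWord_preimage_lift (A := A) (le_max_right n m) R
    exact ⟨_, S' ∪ R', by rw [hS, hR]; rfl⟩
  sdiff_mem := by
    rintro _ _ ⟨n, S, rfl⟩ ⟨m, R, rfl⟩
    obtain ⟨S', hS⟩ := prefixWord_preimage_lift (A := A) (le_max_left n m) S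
    obtain ⟨R', hR⟩ := prefixWord_preimage_lift (A := A) (le_max_right n m) R
    exact ⟨_, S' \ R', by rw [hS, hR]; rfl⟩

theorem univ_mem_cylinderRing : Set.univ ∈ cylinderRing A := ⟨0, Set.univ, rfl⟩

theorem generateFrom_cylinderRing :
    (inferInstance : MeasurableSpace (SFT A)) = MeasurableSpace.generateFrom (cylinderRing A) := by
  refine le_antisymm ?_ (MeasurableSpace.generateFrom_le ?_)
  · have : @Measurable (SFT A) (ℕ → Fin ℓ) (MeasurableSpace.generateFrom (cylinderRing A)) _
        Subtype.val := by
      refine @measurable_pi_lambda _ _ _ (MeasurableSpace.generateFrom (cylinderRing A)) _ _ ?_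
      intro n s _
      exact MeasurableSpace.measurableSet_generateFrom
        ⟨n + 1, {w | w (Fin.last n) ∈ s}, rfl⟩
    exact this.comap_le
  · rintro _ ⟨n, S, rfl⟩
    exact measurable_prefixWord n (Set.toFinite S).measurableSet

/-- Finitely many measurable sets are approximated in measure by cylinder sets of a common
length. -/
theorem exists_prefixWord_symmDiff_lt (μ : Measure (SFT A)) [IsFiniteMeasure μ] {ι : Type*}
    [Fintype ι] {B : ι → Set (SFT A)} (hB : ∀ i, MeasurableSet (B i)) {ε : ℝ} (hε : 0 < ε) :
    ∃ (K : ℕ) (S : ι → Set (Fin K → Fin ℓ)),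
      ∀ i, μ.real (symmDiff (prefixWord K ⁻¹' S i) (B i)) ≤ ε := by
  have h1 : ∀ i, ∃ n, ∃ S : Set (Fin n → Fin ℓ),
      μ.real (symmDiff (prefixWord n ⁻¹' S) (B i)) ≤ ε := fun i => by
    obtain ⟨_, ⟨n, S, rfl⟩, h⟩ := exists_measure_symmDiff_lt_of_generateFrom_isSetRing (μ := μ)
      isSetRing_cylinderRing ⟨{Set.univ}, Set.countable_singleton _,
        Set.singleton_subset_iff.2 univ_mem_cylinderRing, by simp⟩ generateFrom_cylinderRing
      (hB i) (ENNReal.ofReal_pos.2 hε)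
    exact ⟨n, S, ENNReal.toReal_le_of_le_ofReal hε.le h.le⟩
  choose n S h using h1
  have h2 : ∀ i, n i ≤ Finset.univ.sup n := fun i => Finset.le_sup (Finset.mem_univ i)
  choose S' hS' using fun i => prefixWord_preimage_lift (A := A) (h2 i) (S i)
  exact ⟨_, S', fun i => hS' i ▸ h i⟩

/-- A finite measure on a subshift is determined by its values on cylinders. -/
theorem Measure.ext_of_prefixWord {μ ν : Measure (SFT A)} [IsFiniteMeasure μ] [IsFiniteMeasure ν]
    (h : ∀ n (w : Fin n → Fin ℓ), μ.real (prefixWord n ⁻¹' {w}) = ν.real (prefixWord n ⁻¹' {w})) :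
    μ = ν := by
  have hS : ∀ n (S : Set (Fin n → Fin ℓ)),
      μ (prefixWord n ⁻¹' S) = ν (prefixWord n ⁻¹' S) := fun n S => by
    classical
    rw [← measureReal_eq_measureReal_iff,
      show (prefixWord n ⁻¹' S : Set (SFT A)) = ⋃ w ∈ S.toFinset, prefixWord n ⁻¹' {w} by
        ext x; simp]
    have hd : (S.toFinset : Set (Fin n → Fin ℓ)).PairwiseDisjoint
        fun w => (prefixWord n ⁻¹' {w} : Set (SFT A)) := fun w _ w' _ hne =>
      Set.disjoint_left.2 fun x hx hx' => hne (hx.symm.trans hx')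
    have hm : ∀ w ∈ S.toFinset, MeasurableSet (prefixWord n ⁻¹' {w} : Set (SFT A)) :=
      fun w _ => measurable_prefixWord n (measurableSet_singleton w)
    rw [measureReal_biUnion_finset hd hm, measureReal_biUnion_finset hd hm]
    exact Finset.sum_congr rfl fun w _ => h n w
  refine ext_of_generate_finite _ generateFrom_cylinderRing
    isSetRing_cylinderRing.isSetSemiring.isPiSystem ?_ ?_
  · rintro _ ⟨n, S, rfl⟩; exact hS n S
  · exact hS 0 Set.univ

/-- The entropy increments `H(α_{n+1}) - H(α_n)` of the cylinder partitions decrease. -/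
theorem partitionEntropy_prefixWord_increment_antitone {μ : Measure (SFT A)}
    (hμ : IsInvariantProb shift μ) : Antitone fun n : ℕ =>
      partitionEntropy μ (prefixWord (n + 1) : SFT A → _) -
        partitionEntropy μ (prefixWord n : SFT A → _) := by
  have := hμ.1
  -- the increment is the entropy of `x₀` given `x₁, …, x_n`
  have e : ∀ n : ℕ, partitionEntropy μ (prefixWord (n + 1) : SFT A → _) -
      partitionEntropy μ (prefixWord n : SFT A → _) =
      condPartitionEntropy μ (fun x : SFT A => x.1 0) (fun x => prefixWord n (shift x)) := by
    intro n
    have hs := (measurable_prefixWord (A := A) n).comp measurable_shift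
    rw [condPartitionEntropy, partitionEntropy_comp hμ.2 (measurable_prefixWord n)]
    congr 1
    refine partitionEntropy_congr (measurable_prefixWord _) ((measurable_coord 0).prodMk hs) ?_
    intro x y
    rw [prefixWord_succ_eq_iff, Prod.mk.injEq]
  intro n N h
  simp only [e]
  exact condPartitionEntropy_anti (measurable_coord 0)
    ((measurable_prefixWord N).comp measurable_shift)
    ((measurable_prefixWord n).comp measurable_shift) fun x y hxy => prefixWord_eq_of_le h hxy

/-- Given the word of length `n + K`, the itinerary of length `n` with respect to `ξ` has at most
`n` times the entropy of `ξ` given the word of length `K`. -/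
theorem condPartitionEntropy_itinerary_le {μ : Measure (SFT A)} (hμ : IsInvariantProb shift μ)
    {k : ℕ} {ξ : SFT A → Fin k} (hξ : Measurable ξ) (K n : ℕ) :
    condPartitionEntropy μ (itinerary shift ξ n) (prefixWord (n + K) : SFT A → _) ≤
      n * condPartitionEntropy μ ξ (prefixWord K : SFT A → _) := by
  have := hμ.1
  have hit : ∀ n, Measurable (itinerary shift ξ n) := fun n =>
    measurable_pi_lambda _ fun i => hξ.comp (measurable_shift.iterate i)
  induction n with
  | zero =>
    have : condPartitionEntropy μ (itinerary shift ξ 0) (prefixWord (0 + K) : SFT A → _) = 0 := by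
      rw [condPartitionEntropy, sub_eq_zero]
      refine partitionEntropy_congr ((hit 0).prodMk (measurable_prefixWord _))
        (measurable_prefixWord _) fun x y => ?_
      rw [Prod.mk.injEq, and_iff_right (Subsingleton.elim _ _)]
    rw [this]; simp
  | succ n ih =>
    have hs : Measurable fun x : SFT A => itinerary shift ξ n (shift x) :=
      (hit n).comp measurable_shift
    have h1 : condPartitionEntropy μ (itinerary shift ξ (n + 1))
        (prefixWord (n + 1 + K) : SFT A → _) = condPartitionEntropy μ
          (fun x => (ξ x, itinerary shift ξ n (shift x))) (prefixWord (n + 1 + K) : SFT A → _) := by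
      refine condPartitionEntropy_congr (hit _) (hξ.prodMk hs) (measurable_prefixWord _)
        (measurable_prefixWord _) (fun _ _ => Iff.rfl) fun x y _ => ?_
      simp only [Prod.mk.injEq, funext_iff, itinerary, Fin.forall_fin_succ, Fin.val_zero,
        Fin.val_succ, Function.iterate_succ_apply, Function.iterate_zero, id]
    have h2 := condPartitionEntropy_prod_le (μ := μ) hξ hs
      (measurable_prefixWord (A := A) (n + 1 + K))
    have h3 := condPartitionEntropy_anti (μ := μ) hξ (measurable_prefixWord (A := A) (n + 1 + K))
      (measurable_prefixWord K) fun x y => prefixWord_eq_of_le (Nat.le_add_left _ _)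
    have h4 := condPartitionEntropy_anti (μ := μ) hs (measurable_prefixWord (A := A) (n + 1 + K))
      ((measurable_prefixWord (n + K)).comp measurable_shift) fun x y hxy =>
        prefixWord_eq_iff.2 fun i hi => prefixWord_eq_iff.1 hxy (i + 1) (by omega)
    have h5 := condPartitionEntropy_comp hμ.2 (hit n) (measurable_prefixWord (A := A) (n + K))
    rw [h1]
    simp only [Function.comp_def] at h4
    push_cast
    linarith

/-- The Kolmogorov–Sinai inequality: the entropy of a subshift is at most every entropy increment
of the cylinder partitions. -/
theorem ksEntropy_le_increment {μ : Measure (SFT A)} (hμ : IsInvariantProb shift μ) (N : ℕ) :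
    ksEntropy shift μ ≤ ((partitionEntropy μ (prefixWord (N + 1) : SFT A → _) -
        partitionEntropy μ (prefixWord N : SFT A → _) : ℝ) : EReal) := by
  have := hμ.1
  set H : ℕ → ℝ := fun n => partitionEntropy μ (prefixWord n : SFT A → _) with hH
  set d := H (N + 1) - H N with hd
  have hgrow : ∀ n, H (N + n) ≤ H N + n * d := fun n => by
    induction n with
    | zero => simp
    | succ n ih =>
      have := partitionEntropy_prefixWord_increment_antitone hμ (Nat.le_add_right N n)
      change H (N + n + 1) - H (N + n) ≤ d at this
      rw [← add_assoc]; push_cast; linarith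
  refine iSup_le fun k => iSup_le fun ⟨ξ, hξ⟩ => ?_
  -- for `c > d`, half of `c - d` pays for the entropy of `ξ` given a long word
  refine EReal.le_of_forall_lt_iff_le.1 fun c hc => ?_
  rw [EReal.coe_lt_coe_iff] at hc
  obtain ⟨δ, hδ, hδ1, hδc⟩ : ∃ δ : ℝ, 0 < δ ∧ δ ≤ 1 ∧ k * (δ + δ) ≤ (c - d) / 2 := by
    refine ⟨min 1 ((c - d) / (4 * (k + 1))), lt_min one_pos (by have := sub_pos.2 hc; positivity),
      min_le_left _ _, ?_⟩
    have h1 : min 1 ((c - d) / (4 * (k + 1))) ≤ (c - d) / (4 * (k + 1)) := min_le_right _ _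
    rw [le_div_iff₀ (by positivity)] at h1
    have h2 : 0 < min 1 ((c - d) / (4 * (k + 1))) :=
      lt_min one_pos (by have := sub_pos.2 hc; positivity)
    nlinarith
  obtain ⟨K, S, hS⟩ := exists_prefixWord_symmDiff_lt μ (B := fun i => ξ ⁻¹' {i})
    (fun i => hξ (measurableSet_singleton i)) (mul_pos hδ hδ)
  have hcond := condPartitionEntropy_le_of_symmDiff hξ (measurable_prefixWord K) hδ hδ1 S hS
  rw [mul_div_assoc, div_self hδ.ne', mul_one, Fintype.card_fin] at hcond
  have hit : ∀ n, Measurable (itinerary shift ξ n) := fun n =>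
    measurable_pi_lambda _ fun i => hξ.comp (measurable_shift.iterate i)
  have hbound : ∀ n : ℕ, partitionEntropy μ (itinerary shift ξ n) ≤
      (H N + K * d) + n * ((c + d) / 2) := fun n => by
    have h1 := condPartitionEntropy_itinerary_le hμ hξ K n
    have h2 : partitionEntropy μ (itinerary shift ξ n) ≤
        partitionEntropy μ (fun x => (itinerary shift ξ n x, prefixWord (n + K) x)) :=
      partitionEntropy_le_of_factorsThrough ((hit n).prodMk (measurable_prefixWord _)) (hit n)
        fun x y h => (Prod.mk.injEq .. ▸ h).1
    have h3 : H (n + K) ≤ H (N + (n + K)) :=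
      partitionEntropy_le_of_factorsThrough (measurable_prefixWord _) (measurable_prefixWord _)
        fun x y => prefixWord_eq_of_le (Nat.le_add_left _ _)
    have h4 := hgrow (n + K)
    have h5 : (n : ℝ) * condPartitionEntropy μ ξ (prefixWord K : SFT A → _) ≤
        n * ((c - d) / 2) := mul_le_mul_of_nonneg_left (hcond.trans hδc) n.cast_nonneg
    rw [condPartitionEntropy] at h1
    push_cast at h4
    change _ - H (n + K) ≤ _ at h1
    linarith
  refine limsup_le_of_le (h := ?_)
  filter_upwards [eventually_gt_atTop 0,
    tendsto_natCast_atTop_atTop.eventually_ge_atTop ((H N + K * d) / ((c - d) / 2))] with n hn hn'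
  rw [EReal.coe_le_coe_iff, div_le_iff₀ (Nat.cast_pos.2 hn)]
  rw [div_le_iff₀ (half_pos (sub_pos.2 hc))] at hn'
  linarith [hbound n]

end Subshift

/-! ### The transition matrices -/

theorem exA_isPrimitive : exA.IsPrimitive where
  nonneg i j := by
    fin_cases i <;> fin_cases j <;> simp [exA]
  exists_pos_pow := by
    refine ⟨2, by norm_num, fun i j => ?_⟩
    rw [sq, Matrix.mul_apply, Fin.sum_univ_three]
    fin_cases i <;> fin_cases j <;> simp [exA]

/-- The restricted matrix swaps the two symbols. -/
theorem exAΔ_sq : exAΔ ^ 2 = 1 := by decide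

theorem exAΔ_pow_apply_self_pos_iff (i : exΔ) (n : ℕ) : 0 < (exAΔ ^ n) i i ↔ Even n := by
  rcases Nat.even_or_odd' n with ⟨k, rfl | rfl⟩
  · simp [pow_mul, exAΔ_sq]
  · rw [pow_succ, pow_mul, exAΔ_sq, one_pow, one_mul]
    refine iff_of_false ?_ (by simp)
    revert i; decide

theorem exAΔ_isIrreducible : exAΔ.IsIrreducible := by
  have h : ∀ i j, exAΔ i j = if i = j then 0 else 1 := by
    rintro ⟨i, hi⟩ ⟨j, hj⟩
    simp only [exΔ, Finset.mem_insert, Finset.mem_singleton] at hi hj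
    rcases hi with rfl | rfl <;> rcases hj with rfl | rfl <;> simp [exAΔ, exA]
  rw [Matrix.isIrreducible_iff_exists_pow_pos fun i j => by rw [h]; split_ifs <;> simp]
  intro i j
  by_cases hij : i = j
  · exact ⟨2, by norm_num, by rw [exAΔ_sq, hij]; simp⟩
  · exact ⟨1, one_pos, by rw [pow_one, h, if_neg hij]; exact one_pos⟩

theorem exA_two_left (j : Fin 3) : exA 2 j = 1 := by revert j; decide

theorem exA_zero_left_iff {j : Fin 3} : exA 0 j = 1 ↔ j ≠ 0 := by revert j; decide

theorem exA_one_left_iff {j : Fin 3} : exA 1 j = 1 ↔ j ≠ 1 := by revert j; decide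

/-- The constant point `(3, 3, 3, …)`. -/
def pt33 : SFT exA := ⟨fun _ => 2, fun _ => rfl⟩

theorem exP_pos {p q : ℝ} (hpq : Real.exp p + Real.exp q < 1) {i j : Fin 3} (h : exA i j = 1) :
    0 < exP p q j i := by
  have := Real.exp_pos p
  have := Real.exp_pos q
  fin_cases i <;> fin_cases j <;>
    simp [exA, exP, -sub_pos] at h ⊢ <;> linarith

theorem exP_eq_zero (p q : ℝ) {i j : Fin 3} (h : exA i j ≠ 1) : exP p q j i = 0 := by
  fin_cases i <;> fin_cases j <;> simp [exA, exP] at h ⊢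

theorem exP_nonneg {p q : ℝ} (hpq : Real.exp p + Real.exp q < 1) (i j : Fin 3) :
    0 ≤ exP p q i j := by
  by_cases h : exA j i = 1
  · exact (exP_pos hpq h).le
  · exact (exP_eq_zero p q h).ge

theorem exP_row_sum (p q : ℝ) (i : Fin 3) : ∑ j, exP p q i j = 1 := by
  fin_cases i <;> simp [exP, Fin.sum_univ_three]

/-! ### The potential -/

section Potential

variable {ℓ : ℕ} {A : Matrix (Fin ℓ) (Fin ℓ) ℤ}

theorem cons_shift (x : SFT A) : cons (x.1 0) (shift x) (x.2 0) = x := by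
  ext n; cases n <;> rfl

variable {p q : ℝ} {φ : SFT exA → ℝ}

theorem IsExPotential.apply_cons_zero (hφ : IsExPotential p q φ) (x : SFT exA)
    (h : exA 0 (x.1 0) = 1) : φ (cons 0 x h) = p := hφ.eq_p _ rfl

theorem IsExPotential.apply_cons_one (hφ : IsExPotential p q φ) (x : SFT exA)
    (h : exA 1 (x.1 0) = 1) : φ (cons 1 x h) = q := hφ.eq_q _ rfl

/-- Normalisation determines the potential on `C[3]` from its values on `C[1]` and `C[2]`. -/
theorem IsExPotential.exp_apply_cons (hφ : IsExPotential p q φ) (i : Fin 3) (x : SFT exA)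
    (h : exA i (x.1 0) = 1) : Real.exp (φ (cons i x h)) = exP p q (x.1 0) i := by
  have key := hφ.normalised x
  rw [transfer, Fin.sum_univ_three, dif_pos (exA_two_left _)] at key
  obtain h0 | h0 | h0 : x.1 0 = 0 ∨ x.1 0 = 1 ∨ x.1 0 = 2 := by
    generalize x.1 0 = j; revert j; decide
  all_goals
    simp only [exA_zero_left_iff, exA_one_left_iff, h0, hφ.apply_cons_zero, hφ.apply_cons_one,
      ne_eq, not_true_eq_false, not_false_eq_true, dif_pos, dif_neg, zero_add, add_zero,
      smul_eq_mul, mul_one, Fin.reduceEq, not_false_eq_true, zero_ne_one, one_ne_zero] at key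
    obtain rfl | rfl | rfl : i = 0 ∨ i = 1 ∨ i = 2 := by clear h; revert i; decide
    all_goals simp [h0, exP, exA] at h ⊢
    all_goals first
      | exact hφ.apply_cons_zero x _
      | exact hφ.apply_cons_one x _
      | exact eq_sub_of_add_eq' key
      | (rw [sub_sub]; exact eq_sub_of_add_eq' key)

theorem IsExPotential.exp_apply (hφ : IsExPotential p q φ) (x : SFT exA) :
    Real.exp (φ x) = exP p q (x.1 1) (x.1 0) := by
  have := hφ.exp_apply_cons (x.1 0) (shift x) (x.2 0)
  rwa [cons_shift] at this

theorem IsExPotential.apply_eq (hφ : IsExPotential p q φ) (x : SFT exA) :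
    φ x = Real.log (exP p q (x.1 1) (x.1 0)) := by
  rw [← hφ.exp_apply, Real.log_exp]

theorem IsExPotential.exp_add_exp_lt_one (hφ : IsExPotential p q φ) :
    Real.exp p + Real.exp q < 1 := by
  have h := hφ.exp_apply pt33
  have h' := Real.exp_pos (φ pt33)
  rw [h] at h'
  simp [pt33, exP] at h'
  linarith

theorem IsExPotential.unique {φ' : SFT exA → ℝ} (hφ : IsExPotential p q φ)
    (hφ' : IsExPotential p q φ') : φ = φ' :=
  funext fun x => by rw [hφ.apply_eq, hφ'.apply_eq]

/-- The formula `log P(x₁, x₀)` defines such a potential: `P` is stochastic, and its zeros are the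
forbidden transitions. -/
theorem isExPotential_log_exP (hpq : Real.exp p + Real.exp q < 1) :
    IsExPotential p q fun x => Real.log (exP p q (x.1 1) (x.1 0)) where
  holder := by
    set M := ∑ i, ∑ j, |Real.log (exP p q i j)| with hM
    have hle : ∀ i j, |Real.log (exP p q i j)| ≤ M := fun i j =>
      (Finset.single_le_sum (f := fun j => |Real.log (exP p q i j)|) (fun _ _ => abs_nonneg _)
        (Finset.mem_univ j)).trans
      (Finset.single_le_sum (f := fun i => ∑ j, |Real.log (exP p q i j)|)
        (fun _ _ => Finset.sum_nonneg fun _ _ => abs_nonneg _) (Finset.mem_univ i))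
    have hM0 : 0 ≤ M := (abs_nonneg _).trans (hle 0 0)
    refine ⟨1 / 2, by norm_num, by norm_num, 2 * M, fun n x y h => ?_⟩
    rcases n with _ | n
    · rw [pow_zero, mul_one, two_mul]
      exact (abs_sub _ _).trans (add_le_add (hle _ _) (hle _ _))
    · dsimp only
      rw [h 0 (by omega), h 1 (by omega), sub_self, abs_zero]
      positivity
  normalised x := by
    refine Eq.trans ?_ (exP_row_sum p q (x.1 0))
    rw [transfer]
    refine Finset.sum_congr rfl fun i _ => ?_
    by_cases h : exA i (x.1 0) = 1
    · rw [dif_pos h, smul_eq_mul, mul_one]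
      exact Real.exp_log (exP_pos hpq h)
    · rw [dif_neg h, exP_eq_zero p q h]
  eq_p x h := by
    have h1 : x.1 1 ≠ 0 := exA_zero_left_iff.1 (h ▸ x.2 0)
    have : exP p q (x.1 1) 0 = Real.exp p := by
      generalize x.1 1 = j at h1; fin_cases j <;> simp [exP] at h1 ⊢
    rw [h, this, Real.log_exp]
  eq_q x h := by
    have h1 : x.1 1 ≠ 1 := exA_one_left_iff.1 (h ▸ x.2 0)
    have : exP p q (x.1 1) 1 = Real.exp q := by
      generalize x.1 1 = j at h1; fin_cases j <;> simp [exP] at h1 ⊢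
    rw [h, this, Real.log_exp]

theorem exists_isExPotential_iff :
    (∃ φ, IsExPotential p q φ) ↔ Real.exp p + Real.exp q < 1 :=
  ⟨fun ⟨_, hφ⟩ => hφ.exp_add_exp_lt_one, fun h => ⟨_, isExPotential_log_exP h⟩⟩

end Potential

/-! ### Transfer operators -/

theorem exh0_eq_ite (x : SFT exA) : exh0 x = if x.1 0 = 1 then 0 else 1 := by
  simp only [exh0, Set.indicator_apply, Set.mem_ofPred_eq, Pi.one_apply]
  generalize x.1 0 = j
  fin_cases j <;> simp

theorem exh1_eq_ite (x : SFT exA) : exh1 x = if x.1 0 = 0 then 0 else 1 := by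
  simp only [exh1, Set.indicator_apply, Set.mem_ofPred_eq, Pi.one_apply]
  generalize x.1 0 = j
  fin_cases j <;> simp

/-- The point `1x`; where it is not allowed, the junk value is `(1, 2, 1, 2, …)`. -/
def pre0 (x : SFT exA) : SFT exA := if h : exA 0 (x.1 0) = 1 then cons 0 x h else pt12

/-- The point `2x`; where it is not allowed, the junk value is `(2, 1, 2, 1, …)`. -/
def pre1 (x : SFT exA) : SFT exA := if h : exA 1 (x.1 0) = 1 then cons 1 x h else pt21

theorem pre0_apply_zero (x : SFT exA) : (pre0 x).1 0 = 0 := by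
  unfold pre0; split_ifs <;> rfl

theorem pre1_apply_zero (x : SFT exA) : (pre1 x).1 0 = 1 := by
  unfold pre1; split_ifs <;> rfl

@[simp] theorem exh0_pre0 (x : SFT exA) : exh0 (pre0 x) = 1 := by
  simp [exh0_eq_ite, pre0_apply_zero]

@[simp] theorem exh0_pre1 (x : SFT exA) : exh0 (pre1 x) = 0 := by
  simp [exh0_eq_ite, pre1_apply_zero]

@[simp] theorem exh1_pre0 (x : SFT exA) : exh1 (pre0 x) = 0 := by
  simp [exh1_eq_ite, pre0_apply_zero]

@[simp] theorem exh1_pre1 (x : SFT exA) : exh1 (pre1 x) = 1 := by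
  simp [exh1_eq_ite, pre1_apply_zero]

theorem shift_pt12 : shift pt12 = pt21 := by
  ext n : 2; simp only [shift, pt12, pt21, Nat.even_add_one]; split_ifs <;> simp_all

theorem shift_pt21 : shift pt21 = pt12 := by
  ext n : 2; simp only [shift, pt12, pt21, Nat.even_add_one]; split_ifs <;> simp_all

/-- Prepending `1` turns agreement with `(2, 1, 2, …)` into longer agreement with
`(1, 2, 1, …)`. -/
theorem pre0_agree {x : SFT exA} {n : ℕ} (h : ∀ k < n, x.1 k = pt21.1 k) :
    ∀ k < n + 1, (pre0 x).1 k = pt12.1 k := by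
  intro k hk
  unfold pre0
  split_ifs
  · cases k with
    | zero => rfl
    | succ k =>
      rw [← shift_pt12] at h
      exact h k (by omega)
  · rfl

theorem pre1_agree {x : SFT exA} {n : ℕ} (h : ∀ k < n, x.1 k = pt12.1 k) :
    ∀ k < n + 1, (pre1 x).1 k = pt21.1 k := by
  intro k hk
  unfold pre1
  split_ifs
  · cases k with
    | zero => rfl
    | succ k =>
      rw [← shift_pt21] at h
      exact h k (by omega)
  · rfl

theorem iterate_pre0_pre1_agree (n : ℕ) (x : SFT exA) :
    ∀ k < 2 * n, ((pre0 ∘ pre1)^[n] x).1 k = pt12.1 k := by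
  induction n with
  | zero => intro k hk; omega
  | succ n ih =>
    rw [Function.iterate_succ_apply']
    exact pre0_agree (pre1_agree ih)

theorem iterate_pre1_pre0_agree (n : ℕ) (x : SFT exA) :
    ∀ k < 2 * n, ((pre1 ∘ pre0)^[n] x).1 k = pt21.1 k := by
  induction n with
  | zero => intro k hk; omega
  | succ n ih =>
    rw [Function.iterate_succ_apply']
    exact pre1_agree (pre0_agree ih)

/-- A continuous function varies little on long cylinders around a given point. -/
theorem exists_agree_dist_lt {ℓ : ℕ} {A : Matrix (Fin ℓ) (Fin ℓ) ℤ} {E : Type*}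
    [PseudoMetricSpace E] {ψ : SFT A → E} (hψ : Continuous ψ) (z : SFT A) {ε : ℝ} (hε : 0 < ε) :
    ∃ N, ∀ y : SFT A, (∀ k < N, y.1 k = z.1 k) → dist (ψ z) (ψ y) < ε := by
  have h := hψ.continuousAt (x := z) (Metric.ball_mem_nhds (ψ z) hε)
  rw [mem_map, nhds_subtype_eq_comap, mem_comap] at h
  obtain ⟨t, ht, hts⟩ := h
  rw [nhds_pi, Filter.mem_pi] at ht
  obtain ⟨I, hI, s, hs, hst⟩ := ht
  obtain ⟨N, hN⟩ := hI.bddAbove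
  refine ⟨N + 1, fun y hy => ?_⟩
  have := hts (show y ∈ Subtype.val ⁻¹' t from hst fun i hi => by
    rw [hy i (Nat.lt_succ_of_le (hN hi))]; exact mem_of_mem_nhds (hs i))
  rw [dist_comm]; exact this

section Transfer

variable {p q : ℝ} {φ : SFT exA → ℝ} {E : Type*} [AddCommGroup E] [Module ℝ E]

/-- The factors `exh1` and `exh0` switch off the junk values of `pre0` and `pre1`. -/
theorem IsExPotential.transfer_apply (hφ : IsExPotential p q φ) (ψ : SFT exA → E) (x : SFT exA) :
    transfer φ ψ x = (Real.exp p * exh1 x) • ψ (pre0 x) + (Real.exp q * exh0 x) • ψ (pre1 x) +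
      exP p q (x.1 0) 2 • ψ (cons 2 x (exA_two_left _)) := by
  rw [transfer, Fin.sum_univ_three, dif_pos (exA_two_left _), hφ.exp_apply_cons]
  congr 2
  · rw [exh1_eq_ite, pre0]
    by_cases h : x.1 0 = 0
    · have : ¬ exA 0 (x.1 0) = 1 := fun h' => exA_zero_left_iff.1 h' h
      rw [dif_neg this, if_pos h, mul_zero, zero_smul]
    · have := exA_zero_left_iff.2 h
      rw [dif_pos this, dif_pos this, if_neg h, mul_one, hφ.apply_cons_zero]
  · rw [exh0_eq_ite, pre1]
    by_cases h : x.1 0 = 1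
    · have : ¬ exA 1 (x.1 0) = 1 := fun h' => exA_one_left_iff.1 h' h
      rw [dif_neg this, if_pos h, mul_zero, zero_smul]
    · have := exA_one_left_iff.2 h
      rw [dif_pos this, dif_pos this, if_neg h, mul_one, hφ.apply_cons_one]

theorem IsExPotential.transferRestr_apply (hφ : IsExPotential p q φ) (ψ : SFT exA → E)
    (x : SFT exA) : transferRestr φ exΔ ψ x =
      (Real.exp p * exh1 x) • ψ (pre0 x) + (Real.exp q * exh0 x) • ψ (pre1 x) := by
  rw [transferRestr, hφ.transfer_apply, Set.indicator_of_mem, Set.indicator_of_mem,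
    Set.indicator_of_notMem, smul_zero, add_zero]
  · simp [cons, exΔ]
  · simp [pre1_apply_zero, exΔ]
  · simp [pre0_apply_zero, exΔ]

theorem IsExPotential.transferRestr_exh0 (hφ : IsExPotential p q φ) :
    transferRestr φ exΔ exh0 = Real.exp p • exh1 := by
  ext x; simp [hφ.transferRestr_apply]

theorem IsExPotential.transferRestr_exh1 (hφ : IsExPotential p q φ) :
    transferRestr φ exΔ exh1 = Real.exp q • exh0 := by
  ext x; simp [hφ.transferRestr_apply]

/-- Only the alternating words contribute to the even iterates of the restricted operator. -/
theorem IsExPotential.iterate_transferRestr_even (hφ : IsExPotential p q φ) (ψ : SFT exA → E)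
    (n : ℕ) (x : SFT exA) : (transferRestr φ exΔ)^[2 * (n + 1)] ψ x =
      Real.exp ((n + 1) * (p + q)) • (exh0 x • ψ ((pre0 ∘ pre1)^[n + 1] x) +
        exh1 x • ψ ((pre1 ∘ pre0)^[n + 1] x)) := by
  have h2 : ∀ (ψ : SFT exA → E) x, transferRestr φ exΔ (transferRestr φ exΔ ψ) x =
      Real.exp (p + q) • (exh0 x • ψ (pre0 (pre1 x)) + exh1 x • ψ (pre1 (pre0 x))) := by
    intro ψ x
    simp only [hφ.transferRestr_apply, exh0_pre0, exh0_pre1, exh1_pre0, exh1_pre1, mul_zero,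
      mul_one, zero_smul, zero_add, add_zero, smul_smul, smul_add, Real.exp_add]
    rw [add_comm]
    congr 2 <;> ring
  induction n generalizing x with
  | zero => simp [h2]
  | succ n ih =>
    rw [show 2 * (n + 1 + 1) = (2 * (n + 1)).succ.succ by omega, Function.iterate_succ_apply',
      Function.iterate_succ_apply', h2, ih, ih, Function.iterate_succ_apply _ (n + 1),
      Function.iterate_succ_apply _ (n + 1)]
    simp only [Function.comp_apply, exh0_pre0, exh0_pre1, exh1_pre0, exh1_pre1, zero_smul, one_smul,
      zero_add, add_zero]
    rw [smul_comm _ (Real.exp _), smul_comm _ (Real.exp _), ← smul_add, smul_smul, ← Real.exp_add]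
    congr 2
    push_cast; ring

end Transfer

section TransferLimits

variable {p q : ℝ} {φ : SFT exA → ℝ}

/-- The only word that contributes is `12`, which may precede `x` if and only if `x₀ ≠ 2`. -/
theorem IsExPotential.transferWord_zero_one_apply (hφ : IsExPotential p q φ) (ψ : SFT exA → ℝ)
    (x : SFT exA) : transferWord φ 0 1 ψ x = Real.exp (p + q) * (exh0 x * ψ (pre0 (pre1 x))) := by
  have inner : ∀ y, transfer φ ({x : SFT exA | x.1 0 = 0 ∧ x.1 1 = 1}.indicator ψ) y =
      if y.1 0 = 1 then Real.exp p * ψ (pre0 y) else 0 := by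
    intro y
    rw [hφ.transfer_apply, Set.indicator_of_notMem (a := pre1 y) (by simp [pre1_apply_zero]),
      Set.indicator_of_notMem (a := cons 2 y _) (by simp [cons]), smul_zero, smul_zero, add_zero,
      add_zero, exh1_eq_ite]
    by_cases h0 : y.1 0 = 0
    · simp [h0]
    · have h1 : (pre0 y).1 1 = y.1 0 := by rw [pre0, dif_pos (exA_zero_left_iff.2 h0)]; rfl
      by_cases h : y.1 0 = 1
      · rw [Set.indicator_of_mem (by simp [h1, h, pre0_apply_zero])]; simp [h]
      · rw [Set.indicator_of_notMem (by simp [h1, h])]; simp [h]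
  rw [transferWord, hφ.transfer_apply, inner, inner, inner, if_pos (pre1_apply_zero x),
    if_neg (by simp [pre0_apply_zero]), if_neg (by simp [cons]), Real.exp_add]
  simp only [smul_eq_mul]
  ring

theorem IsExPotential.transferWord_one_zero_apply (hφ : IsExPotential p q φ) (ψ : SFT exA → ℝ)
    (x : SFT exA) : transferWord φ 1 0 ψ x = Real.exp (p + q) * (exh1 x * ψ (pre1 (pre0 x))) := by
  have inner : ∀ y, transfer φ ({x : SFT exA | x.1 0 = 1 ∧ x.1 1 = 0}.indicator ψ) y =
      if y.1 0 = 0 then Real.exp q * ψ (pre1 y) else 0 := by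
    intro y
    rw [hφ.transfer_apply, Set.indicator_of_notMem (a := pre0 y) (by simp [pre0_apply_zero]),
      Set.indicator_of_notMem (a := cons 2 y _) (by simp [cons]), smul_zero, smul_zero, zero_add,
      add_zero, exh0_eq_ite]
    by_cases h0 : y.1 0 = 1
    · simp [h0]
    · have h1 : (pre1 y).1 1 = y.1 0 := by rw [pre1, dif_pos (exA_one_left_iff.2 h0)]; rfl
      by_cases h : y.1 0 = 0
      · rw [Set.indicator_of_mem (by simp [h1, h, pre1_apply_zero])]; simp [h]
      · rw [Set.indicator_of_notMem (by simp [h1, h])]; simp [h]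
  rw [transferWord, hφ.transfer_apply, inner, inner, inner, if_pos (pre0_apply_zero x),
    if_neg (by simp [pre1_apply_zero]), if_neg (by simp [cons]), Real.exp_add]
  simp only [smul_eq_mul]
  ring

theorem IsExPotential.iterate_transferWord_zero_one (hφ : IsExPotential p q φ) (n : ℕ)
    (x : SFT exA) : ((transferWord φ 0 1)^[n + 1] (fun _ => 1)) x =
      Real.exp ((n + 1) * (p + q)) * exh0 x := by
  induction n generalizing x with
  | zero => simp [hφ.transferWord_zero_one_apply]
  | succ n ih =>
    rw [Function.iterate_succ_apply', hφ.transferWord_zero_one_apply, ih, exh0_pre0]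
    rw [show Real.exp (((n + 1 : ℕ) + 1) * (p + q)) =
      Real.exp (p + q) * Real.exp ((n + 1) * (p + q)) by rw [← Real.exp_add]; push_cast; ring_nf]
    ring

theorem IsExPotential.iterate_transferWord_one_zero (hφ : IsExPotential p q φ) (n : ℕ)
    (x : SFT exA) : ((transferWord φ 1 0)^[n + 1] (fun _ => 1)) x =
      Real.exp ((n + 1) * (p + q)) * exh1 x := by
  induction n generalizing x with
  | zero => simp [hφ.transferWord_one_zero_apply]
  | succ n ih =>
    rw [Function.iterate_succ_apply', hφ.transferWord_one_zero_apply, ih, exh1_pre1]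
    rw [show Real.exp (((n + 1 : ℕ) + 1) * (p + q)) =
      Real.exp (p + q) * Real.exp ((n + 1) * (p + q)) by rw [← Real.exp_add]; push_cast; ring_nf]
    ring

theorem IsExPotential.tendsto_transferWord_zero_one (hφ : IsExPotential p q φ) (x : SFT exA) :
    Tendsto (fun n : ℕ => Real.exp (-(2 * n * ((p + q) / 2))) *
      ((transferWord φ 0 1)^[n] (fun _ => 1)) x) atTop (𝓝 (exh0 x)) := by
  refine tendsto_const_nhds.congr' ?_
  filter_upwards [eventually_ge_atTop 1] with n hn
  obtain ⟨n, rfl⟩ := Nat.exists_eq_add_of_le' hn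
  rw [hφ.iterate_transferWord_zero_one, ← mul_assoc, ← Real.exp_add]
  have : -(2 * ((n + 1 : ℕ) : ℝ) * ((p + q) / 2)) + (n + 1) * (p + q) = 0 := by push_cast; ring
  rw [this, Real.exp_zero, one_mul]

theorem IsExPotential.tendsto_transferWord_one_zero (hφ : IsExPotential p q φ) (x : SFT exA) :
    Tendsto (fun n : ℕ => Real.exp (-(2 * n * ((p + q) / 2))) *
      ((transferWord φ 1 0)^[n] (fun _ => 1)) x) atTop (𝓝 (exh1 x)) := by
  refine tendsto_const_nhds.congr' ?_
  filter_upwards [eventually_ge_atTop 1] with n hn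
  obtain ⟨n, rfl⟩ := Nat.exists_eq_add_of_le' hn
  rw [hφ.iterate_transferWord_one_zero, ← mul_assoc, ← Real.exp_add]
  have : -(2 * ((n + 1 : ℕ) : ℝ) * ((p + q) / 2)) + (n + 1) * (p + q) = 0 := by push_cast; ring
  rw [this, Real.exp_zero, one_mul]

variable {E : Type*} [NormedAddCommGroup E] [NormedSpace ℝ E]

theorem exh0_nonneg_le_one (x : SFT exA) : 0 ≤ exh0 x ∧ exh0 x ≤ 1 := by
  rw [exh0_eq_ite]; split_ifs <;> norm_num

theorem exh1_nonneg_le_one (x : SFT exA) : 0 ≤ exh1 x ∧ exh1 x ≤ 1 := by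
  rw [exh1_eq_ite]; split_ifs <;> norm_num

/-- Bounded multiples of a continuous function, evaluated along points that agree with `z` on
longer and longer words, converge uniformly. -/
theorem tendstoUniformly_smul_of_agree {ψ : SFT exA → E} (hψ : Continuous ψ) (z : SFT exA)
    {c : SFT exA → ℝ} {C : ℝ} (hc : ∀ x, |c x| ≤ C) {y : ℕ → SFT exA → SFT exA}
    (hy : ∀ n x, ∀ k < 2 * n, (y n x).1 k = z.1 k) :
    TendstoUniformly (fun n x => c x • ψ (y n x)) (fun x => c x • ψ z) atTop := by
  rw [Metric.tendstoUniformly_iff]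
  intro ε hε
  have hC : 0 ≤ C := (abs_nonneg _).trans (hc z)
  obtain ⟨N, hN⟩ := exists_agree_dist_lt hψ z (ε := ε / (C + 1)) (by positivity)
  filter_upwards [eventually_ge_atTop N] with n hn x
  have h := hN (y n x) fun k hk => hy n x k (by omega)
  rw [dist_smul₀, Real.norm_eq_abs]
  rw [lt_div_iff₀ (by positivity)] at h
  have := mul_le_mul_of_nonneg_right (hc x) (dist_nonneg (x := ψ z) (y := ψ (y n x)))
  nlinarith [dist_nonneg (x := ψ z) (y := ψ (y n x))]

theorem IsExPotential.tendstoUniformly_even (hφ : IsExPotential p q φ) {ψ : SFT exA → E}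
    (hψ : Continuous ψ) :
    TendstoUniformly
      (fun (n : ℕ) x => Real.exp (-((2 * n : ℕ) * ((p + q) / 2))) •
        ((transferRestr φ exΔ)^[2 * n] ψ) x)
      (fun x => exh0 x • ψ pt12 + exh1 x • ψ pt21) atTop := by
  have h0 := tendstoUniformly_smul_of_agree hψ pt12 (c := exh0) (C := 1)
    (fun x => abs_le.2 ⟨by linarith [(exh0_nonneg_le_one x).1], (exh0_nonneg_le_one x).2⟩)
    iterate_pre0_pre1_agree
  have h1 := tendstoUniformly_smul_of_agree hψ pt21 (c := exh1) (C := 1)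
    (fun x => abs_le.2 ⟨by linarith [(exh1_nonneg_le_one x).1], (exh1_nonneg_le_one x).2⟩)
    iterate_pre1_pre0_agree
  refine tendstoUniformlyOn_univ.1 ((tendstoUniformlyOn_univ.2 (h0.add h1)).congr ?_)
  filter_upwards [eventually_ge_atTop 1] with n hn x _
  obtain ⟨n, rfl⟩ := Nat.exists_eq_add_of_le' hn
  dsimp only
  rw [hφ.iterate_transferRestr_even, smul_smul, ← Real.exp_add]
  have : -(((2 * (n + 1) : ℕ) : ℝ) * ((p + q) / 2)) + (n + 1) * (p + q) = 0 := by push_cast; ring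
  rw [this, Real.exp_zero, one_smul]
  rfl

theorem IsExPotential.tendstoUniformly_odd (hφ : IsExPotential p q φ) {ψ : SFT exA → E}
    (hψ : Continuous ψ) :
    TendstoUniformly
      (fun (n : ℕ) x => Real.exp (-((2 * n + 1 : ℕ) * ((p + q) / 2))) •
        ((transferRestr φ exΔ)^[2 * n + 1] ψ) x)
      (fun x => Real.exp ((p - q) / 2) • exh1 x • ψ pt12 +
        Real.exp ((q - p) / 2) • exh0 x • ψ pt21) atTop := by
  have bound : ∀ {t c : ℝ}, 0 ≤ c ∧ c ≤ 1 → |Real.exp t * c| ≤ Real.exp t := fun {t c} h => by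
    rw [abs_of_nonneg (mul_nonneg (Real.exp_pos t).le h.1)]
    exact mul_le_of_le_one_right (Real.exp_pos t).le h.2
  have h0 := tendstoUniformly_smul_of_agree hψ pt12
    (c := fun x => Real.exp ((p - q) / 2) * exh1 x) (fun x => bound (exh1_nonneg_le_one x))
    (y := fun n x => (pre0 ∘ pre1)^[n] (pre0 x)) (fun n x => iterate_pre0_pre1_agree n _)
  have h1 := tendstoUniformly_smul_of_agree hψ pt21
    (c := fun x => Real.exp ((q - p) / 2) * exh0 x) (fun x => bound (exh0_nonneg_le_one x))
    (y := fun n x => (pre1 ∘ pre0)^[n] (pre1 x)) (fun n x => iterate_pre1_pre0_agree n _)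
  simp only [smul_smul]
  refine tendstoUniformlyOn_univ.1 ((tendstoUniformlyOn_univ.2 (h0.add h1)).congr ?_)
  filter_upwards [eventually_ge_atTop 1] with n hn x _
  obtain ⟨n, rfl⟩ := Nat.exists_eq_add_of_le' hn
  dsimp only
  rw [Function.iterate_succ_apply', hφ.transferRestr_apply, hφ.iterate_transferRestr_even,
    hφ.iterate_transferRestr_even]
  simp only [exh0_pre0, exh0_pre1, exh1_pre0, exh1_pre1, zero_smul, one_smul, zero_add, add_zero,
    smul_add, smul_smul, Pi.add_apply]
  have e1 : Real.exp ((p - q) / 2) = Real.exp (-(((2 * (n + 1) + 1 : ℕ) : ℝ) * ((p + q) / 2))) *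
      Real.exp p * Real.exp ((n + 1) * (p + q)) := by
    rw [← Real.exp_add, ← Real.exp_add]; congr 1; push_cast; ring
  have e2 : Real.exp ((q - p) / 2) = Real.exp (-(((2 * (n + 1) + 1 : ℕ) : ℝ) * ((p + q) / 2))) *
      Real.exp q * Real.exp ((n + 1) * (p + q)) := by
    rw [← Real.exp_add, ← Real.exp_add]; congr 1; push_cast; ring
  rw [e1, e2]
  congr 2 <;> ring

end TransferLimits

/-! ### The subsystem -/

section Subsystem

variable {p q : ℝ} {φ : SFT exA → ℝ}

/-- Within the sub-alphabet every symbol determines the next one. -/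
theorem agree_of_mem_survivors {n : ℕ} {x y : SFT exA} (hx : x ∈ survivors exA exΔ n)
    (hy : y ∈ subsystem exA exΔ) (h0 : x.1 0 = y.1 0) : ∀ k < n, x.1 k = y.1 k := by
  have step : ∀ i j : Fin 3, exA i j = 1 → i ∈ exΔ → j ∈ exΔ → j = if i = 0 then 1 else 0 := by
    intro i j
    fin_cases i <;> fin_cases j <;> simp [exA, exΔ]
  intro k hk
  induction k with
  | zero => exact h0
  | succ k ih =>
    rw [step _ _ (x.2 k) (hx k (by omega)) (hx (k + 1) hk),
      step _ _ (y.2 k) (hy k) (hy (k + 1)), ih (by omega)]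

theorem subsystem_eq : subsystem exA exΔ = {pt12, pt21} := by
  ext x
  simp only [Set.mem_insert_iff, Set.mem_singleton_iff]
  refine ⟨fun hx => ?_, ?_⟩
  · have key : ∀ y ∈ subsystem exA exΔ, x.1 0 = y.1 0 → x = y := fun y hy h0 =>
      Subtype.ext (funext fun n =>
        agree_of_mem_survivors (n := n + 1) (fun i _ => hx i) hy h0 n n.lt_succ_self)
    have h0 : x.1 0 = 0 ∨ x.1 0 = 1 := by simpa [exΔ] using hx 0
    exact h0.imp (fun h => key _ pt12_mem h) fun h => key _ pt21_mem h
  · rintro (rfl | rfl)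
    · exact pt12_mem
    · exact pt21_mem

/-- `(1, 2, 1, 2, …)` as a point of the subsystem. -/
abbrev subPt12 : subsystem exA exΔ := ⟨pt12, pt12_mem⟩

/-- `(2, 1, 2, 1, …)` as a point of the subsystem. -/
abbrev subPt21 : subsystem exA exΔ := ⟨pt21, pt21_mem⟩

theorem subsystem_cases (x : subsystem exA exΔ) : x = subPt12 ∨ x = subPt21 := by
  exact ((Set.ext_iff.1 subsystem_eq x.1).1 x.2).imp Subtype.ext Subtype.ext

instance : Finite (subsystem exA exΔ) :=
  Finite.of_surjective (fun b : Bool => if b then subPt12 else subPt21) fun x =>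
    (subsystem_cases x).elim (fun h => ⟨true, by simp [h]⟩) fun h => ⟨false, by simp [h]⟩

theorem pt12_ne_pt21 : pt12 ≠ pt21 := fun h => by
  have := congrArg (fun x : SFT exA => x.1 0) h
  simp [pt12, pt21] at this

theorem subPt12_ne_subPt21 : subPt12 ≠ subPt21 := fun h => pt12_ne_pt21 (congrArg Subtype.val h)

theorem subShift_subPt12 : subShift exA exΔ subPt12 = subPt21 := Subtype.ext shift_pt12

theorem subShift_subPt21 : subShift exA exΔ subPt21 = subPt12 := Subtype.ext shift_pt21

theorem isInvariantProb_subShift_iff (m : Measure (subsystem exA exΔ)) :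
    IsInvariantProb (subShift exA exΔ) m ↔
      m = (2 : ENNReal)⁻¹ • (Measure.dirac subPt12 + Measure.dirac subPt21) := by
  have hmeas : Measurable (subShift exA exΔ) := measurable_of_finite _
  have huniv : (Set.univ : Set (subsystem exA exΔ)) = {subPt12} ∪ {subPt21} := by
    ext x; simpa [or_comm] using subsystem_cases x
  constructor
  · rintro ⟨hp, hm⟩
    have h1 : m {subPt12} = m {subPt21} := by
      rw [← hm.measure_preimage (measurableSet_singleton subPt21).nullMeasurableSet]
      congr 1
      ext x
      rcases subsystem_cases x with rfl | rfl
      · simp [subShift_subPt12]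
      · simp [subShift_subPt21, pt12_ne_pt21, pt12_ne_pt21.symm]
    have h2 : m {subPt12} + m {subPt21} = 1 := by
      rw [← measure_union (by simpa using subPt12_ne_subPt21) (measurableSet_singleton _),
        ← huniv, measure_univ]
    have h3 : m {subPt12} = 2⁻¹ := by
      rw [← h1, ← two_mul, mul_comm] at h2
      exact ENNReal.eq_inv_of_mul_eq_one_left h2
    refine Measure.ext_of_singleton fun x => ?_
    rcases subsystem_cases x with rfl | rfl
    · rw [h3]; simp [pt12_ne_pt21.symm]
    · rw [← h1, h3]; simp [pt12_ne_pt21]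
  · rintro rfl
    refine ⟨⟨?_⟩, hmeas, ?_⟩
    · simp [ENNReal.inv_two_add_inv_two]
    · rw [Measure.map_smul, Measure.map_add _ _ hmeas, Measure.map_dirac' hmeas,
        Measure.map_dirac' hmeas, subShift_subPt12, subShift_subPt21, add_comm]

theorem partitionEntropy_nonneg {X ι : Type*} [MeasurableSpace X] [Fintype ι] (μ : Measure X)
    [IsProbabilityMeasure μ] (ξ : X → ι) : 0 ≤ partitionEntropy μ ξ :=
  Finset.sum_nonneg fun _ _ => Real.negMulLog_nonneg measureReal_nonneg measureReal_le_one

theorem ksEntropy_nonneg {X : Type*} [MeasurableSpace X] (T : X → X) (μ : Measure X)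
    [IsProbabilityMeasure μ] : 0 ≤ ksEntropy T μ := by
  refine le_trans ?_ (le_iSup_of_le 1 (le_iSup_of_le ⟨fun _ => 0, measurable_const⟩ le_rfl))
  refine le_limsup_of_frequently_le (Frequently.of_forall fun n => ?_)
  exact_mod_cast div_nonneg (partitionEntropy_nonneg μ _) n.cast_nonneg

/-- On a finite space every transformation has entropy zero. -/
theorem ksEntropy_eq_zero_of_finite {X : Type*} [MeasurableSpace X] [MeasurableSingletonClass X]
    [Finite X] (T : X → X) (μ : Measure X) [IsProbabilityMeasure μ] : ksEntropy T μ = 0 := by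
  have := Fintype.ofFinite X
  refine le_antisymm (iSup_le fun k => iSup_le fun ξ => ?_) (ksEntropy_nonneg T μ)
  -- the entropies of all itineraries are bounded by that of the partition into points
  have hlim : Tendsto (fun n : ℕ => ((partitionEntropy μ (id : X → X) / n : ℝ) : EReal)) atTop
      (𝓝 ((0 : ℝ) : EReal)) :=
    (continuous_coe_real_ereal.tendsto _).comp (tendsto_const_div_atTop_nhds_zero_nat _)
  rw [EReal.coe_zero] at hlim
  rw [← hlim.limsup_eq]
  refine limsup_le_limsup (Eventually.of_forall fun n => ?_)
  rw [EReal.coe_le_coe_iff]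
  gcongr
  exact partitionEntropy_le_of_factorsThrough measurable_id (measurable_of_finite _)
    fun x y h => congrArg _ h

theorem IsExPotential.subPressure_eq (hφ : IsExPotential p q φ) :
    subPressure φ exΔ = (((p + q) / 2 : ℝ) : EReal) := by
  have key : ∀ m : Measure (subsystem exA exΔ), IsInvariantProb (subShift exA exΔ) m →
      ksEntropy (subShift exA exΔ) m + ((∫ x, φ x.1 ∂m : ℝ) : EReal) =
        (((p + q) / 2 : ℝ) : EReal) := by
    intro m hm
    have := hm.1
    rw [ksEntropy_eq_zero_of_finite, zero_add]
    congr 1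
    rw [(isInvariantProb_subShift_iff m).1 hm, integral_smul_measure, integral_add_measure
      (Integrable.of_finite) (Integrable.of_finite), integral_dirac, integral_dirac,
      hφ.eq_p pt12 rfl, hφ.eq_q pt21 rfl]
    simp; ring
  have : Nonempty {m // IsInvariantProb (subShift exA exΔ) m} :=
    ⟨⟨_, (isInvariantProb_subShift_iff _).2 rfl⟩⟩
  rw [subPressure, pressure, iSup_congr fun m : {m // IsInvariantProb (subShift exA exΔ) m} =>
    key m.1 m.2, iSup_const]

theorem IsExPotential.exPress_eq (hφ : IsExPotential p q φ) : exPress φ = (p + q) / 2 := by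
  rw [exPress, hφ.subPressure_eq, EReal.toReal_coe]

end Subsystem

/-! ### Markov measures -/

section Markov

variable {ℓ : ℕ}

/-- The measure on a finite alphabet with the given weights (negative weights count as zero). -/
def weightMeasure (f : Fin ℓ → ℝ) : Measure (Fin ℓ) :=
  ∑ j, ENNReal.ofReal (f j) • Measure.dirac j

theorem weightMeasure_singleton (f : Fin ℓ → ℝ) (j : Fin ℓ) :
    weightMeasure f {j} = ENNReal.ofReal (f j) := by
  rw [weightMeasure, Measure.finsetSum_apply, Finset.sum_eq_single j]
  · simp
  · intro i _ hij; simp [hij]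
  · simp

theorem isProbabilityMeasure_weightMeasure {f : Fin ℓ → ℝ} (h0 : ∀ j, 0 ≤ f j)
    (h1 : ∑ j, f j = 1) : IsProbabilityMeasure (weightMeasure f) := by
  refine ⟨?_⟩
  simp only [weightMeasure, Measure.finsetSum_apply, Measure.smul_apply, measure_univ, smul_eq_mul,
    mul_one]
  rw [← ENNReal.ofReal_sum_of_nonneg fun j _ => h0 j, h1, ENNReal.ofReal_one]

/-- The transition kernel of a stochastic matrix, as a kernel on finite histories that depends on
the last symbol only. -/
def historyKernel (Q : Matrix (Fin ℓ) (Fin ℓ) ℝ) (n : ℕ) :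
    ProbabilityTheory.Kernel (Finset.Iic n → Fin ℓ) (Fin ℓ) where
  toFun y := weightMeasure (Q (y ⟨n, Finset.mem_Iic.2 le_rfl⟩))
  measurable' := measurable_of_finite _

/-- A Markov chain with given initial law and transition matrix exists on the full shift: after any
set of histories that end in `i`, the next symbol is `j` with probability `Q i j`. -/
theorem exists_markovChain {π : Fin ℓ → ℝ} {Q : Matrix (Fin ℓ) (Fin ℓ) ℝ} (hπ0 : ∀ i, 0 ≤ π i)
    (hπ1 : ∑ i, π i = 1) (hQ0 : ∀ i j, 0 ≤ Q i j) (hQ1 : ∀ i, ∑ j, Q i j = 1) :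
    ∃ μ : Measure (ℕ → Fin ℓ), IsProbabilityMeasure μ ∧
      (∀ i, μ {x | x 0 = i} = ENNReal.ofReal (π i)) ∧
      ∀ (n : ℕ) (s : Set (Finset.Iic n → Fin ℓ)) (i j : Fin ℓ),
        (∀ y ∈ s, y ⟨n, Finset.mem_Iic.2 le_rfl⟩ = i) →
        μ {x | Preorder.frestrictLe n x ∈ s ∧ x (n + 1) = j} =
          ENNReal.ofReal (Q i j) * μ {x | Preorder.frestrictLe n x ∈ s} := by
  have := isProbabilityMeasure_weightMeasure hπ0 hπ1
  have hker : ∀ n, ProbabilityTheory.IsMarkovKernel (historyKernel Q n) := fun n =>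
    ⟨fun y => isProbabilityMeasure_weightMeasure (hQ0 _) (hQ1 _)⟩
  let κ : (n : ℕ) → ProbabilityTheory.Kernel ((i : Finset.Iic n) → (fun _ : ℕ => Fin ℓ) i)
    ((fun _ : ℕ => Fin ℓ) (n + 1)) := historyKernel Q
  have hκ : ∀ n, ProbabilityTheory.IsMarkovKernel (κ n) := hker
  let μ := ProbabilityTheory.Kernel.trajMeasure (X := fun _ : ℕ => Fin ℓ) (weightMeasure π) κ
  refine ⟨μ, inferInstance, fun i => ?_, fun n s i j hs => ?_⟩
  · have h : μ.map (Preorder.frestrictLe 0) = (weightMeasure π).map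
        (MeasurableEquiv.piUnique (fun i : Finset.Iic 0 => (fun _ : ℕ => Fin ℓ) i)).symm := by
      simp only [μ]
      rw [ProbabilityTheory.Kernel.trajMeasure, Measure.map_comp _ _ (by fun_prop),
        ProbabilityTheory.Kernel.traj_map_frestrictLe,
        ProbabilityTheory.Kernel.partialTraj_self, Measure.id_comp]
    have h2 := congrArg (fun ν => ν {y | y ⟨0, Finset.mem_Iic.2 le_rfl⟩ = i}) h
    dsimp only at h2
    rw [Measure.map_apply (by fun_prop) (Set.toFinite _).measurableSet,
      Measure.map_apply (by fun_prop) (Set.toFinite _).measurableSet] at h2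
    refine h2.trans ?_
    rw [← weightMeasure_singleton]
    congr 1
  · have h := ProbabilityTheory.Kernel.map_frestrictLe_trajMeasure_compProd_eq_map_trajMeasure
      (X := fun _ : ℕ => Fin ℓ) (μ₀ := weightMeasure π) (κ := κ) (a := n)
    have hsm : MeasurableSet s := (Set.toFinite _).measurableSet
    have h2 := congrArg (fun ν => ν (s ×ˢ {j})) h
    rw [Measure.compProd_apply_prod hsm (measurableSet_singleton j),
      Measure.map_apply (by fun_prop) (hsm.prod (measurableSet_singleton j))] at h2
    refine h2.symm.trans ?_
    rw [setLIntegral_congr_fun (g := fun _ => ENNReal.ofReal (Q i j)) hsm fun y hy => by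
      change weightMeasure (Q (y ⟨n, Finset.mem_Iic.2 le_rfl⟩)) {j} = _
      rw [hs y hy, weightMeasure_singleton], setLIntegral_const,
      Measure.map_apply (by fun_prop) hsm]
    rfl

variable {A : Matrix (Fin ℓ) (Fin ℓ) ℤ}

theorem preimage_prefixWord_eq_cyl {m : ℕ} (w : Fin (m + 1) → Fin ℓ) :
    (prefixWord (m + 1) ⁻¹' {w} : Set (SFT A)) = cyl A 0 w := by
  ext x; simp [cyl, prefixWord, funext_iff]

theorem cyl_eq_preimage_iterate_shift (k : ℕ) {m : ℕ} (w : Fin (m + 1) → Fin ℓ) :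
    cyl A k w = shift^[k] ⁻¹' cyl A 0 w := by
  ext x; simp [cyl, iterate_shift_apply]

/-- A stochastic matrix that vanishes on the forbidden transitions has a Markov measure on the
subshift. -/
theorem exists_isMarkovMeasure {π : Fin ℓ → ℝ} {Q : Matrix (Fin ℓ) (Fin ℓ) ℝ} (hπ0 : ∀ i, 0 ≤ π i)
    (hπ1 : ∑ i, π i = 1) (hQ0 : ∀ i j, 0 ≤ Q i j) (hQ1 : ∀ i, ∑ j, Q i j = 1)
    (hstat : Matrix.vecMul π Q = π) (hA : ∀ i j, A i j ≠ 1 → Q i j = 0) :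
    ∃ μ : Measure (SFT A), IsProbabilityMeasure μ ∧ IsMarkovMeasure μ π Q := by
  obtain ⟨ν, hν, hinit, hstep⟩ := exists_markovChain hπ0 hπ1 hQ0 hQ1
  have hrange : Set.range (Subtype.val : SFT A → ℕ → Fin ℓ) = {x | ∀ i, A (x i) (x (i + 1)) = 1} :=
    Subtype.range_coe
  -- forbidden transitions have probability zero, so the chain lives on the subshift
  have hnull : ν (Set.range (Subtype.val : SFT A → ℕ → Fin ℓ))ᶜ = 0 := by
    have hsub : (Set.range (Subtype.val : SFT A → ℕ → Fin ℓ))ᶜ ⊆ ⋃ n : ℕ, ⋃ i, ⋃ j,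
        ⋃ _ : A i j ≠ 1, {x | Preorder.frestrictLe n x ∈
          {y : Finset.Iic n → Fin ℓ | y ⟨n, Finset.mem_Iic.2 le_rfl⟩ = i} ∧ x (n + 1) = j} := by
      intro x hx
      rw [hrange, Set.mem_compl_iff, Set.mem_ofPred_eq, not_forall] at hx
      obtain ⟨n, hn⟩ := hx
      simp only [Set.mem_iUnion]
      exact ⟨n, x n, x (n + 1), hn, rfl, rfl⟩
    refine measure_mono_null hsub ?_
    simp only [measure_iUnion_null_iff]
    intro n i j hij
    rw [hstep n {y | y ⟨n, Finset.mem_Iic.2 le_rfl⟩ = i} i j fun y hy => hy, hA i j hij,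
      ENNReal.ofReal_zero, zero_mul]
  have hmeas : MeasurableSet (Set.range (Subtype.val : SFT A → ℕ → Fin ℓ)) := by
    rw [hrange, Set.ofPred_forall]
    refine MeasurableSet.iInter fun i => ?_
    have : Measurable fun x : ℕ → Fin ℓ => (x i, x (i + 1)) :=
      (measurable_pi_apply i).prodMk (measurable_pi_apply (i + 1))
    exact this (Set.toFinite {c : Fin ℓ × Fin ℓ | A c.1 c.2 = 1}).measurableSet
  have hemb : MeasurableEmbedding (Subtype.val : SFT A → ℕ → Fin ℓ) := by
    rw [hrange] at hmeas
    exact MeasurableEmbedding.subtype_coe hmeas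
  have hpre : ∀ S, ν.comap (Subtype.val : SFT A → ℕ → Fin ℓ) (Subtype.val ⁻¹' S) = ν S :=
      fun S => by
    rw [hemb.comap_preimage, measure_inter_conull hnull]
  have hcyl : ∀ (m : ℕ) (w : Fin (m + 1) → Fin ℓ), ν {x | ∀ j : Fin (m + 1), x j = w j} =
      ENNReal.ofReal (π (w 0) * ∏ r : Fin m, Q (w r.castSucc) (w r.succ)) := by
    intro m
    induction m with
    | zero => intro w; simp [Fin.forall_fin_succ, hinit]
    | succ m ih =>
      intro w
      have h := hstep m {y | ∀ j : Fin (m + 1), y ⟨j, Finset.mem_Iic.2 (by omega)⟩ = w j.castSucc}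
        (w (Fin.last m).castSucc) (w (Fin.last (m + 1))) fun y hy => hy (Fin.last m)
      have e1 : {x : ℕ → Fin ℓ | ∀ j : Fin (m + 1 + 1), x j = w j} =
          {x | Preorder.frestrictLe (π := fun _ => Fin ℓ) m x ∈
            {y : Finset.Iic m → Fin ℓ | ∀ j : Fin (m + 1),
            y ⟨j, Finset.mem_Iic.2 (by omega)⟩ = w j.castSucc} ∧
              x (m + 1) = w (Fin.last (m + 1))} := by
        ext x
        simp only [Set.mem_ofPred_eq]
        rw [Fin.forall_fin_succ']
        rfl
      have e2 := ih fun j => w j.castSucc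
      rw [e1, h]
      change _ * ν {x : ℕ → Fin ℓ | ∀ j : Fin (m + 1), x j = w j.castSucc} = _
      rw [e2, ← ENNReal.ofReal_mul (hQ0 _ _), Fin.prod_univ_castSucc]
      congr 1
      simp only [Fin.succ_last, Fin.castSucc_zero, Fin.succ_castSucc]
      ring
  refine ⟨ν.comap Subtype.val, ⟨?_⟩, hπ0, hπ1, hQ0, hQ1, hstat, fun m w => ?_⟩
  · rw [← Set.preimage_univ (f := Subtype.val), hpre, measure_univ]
  · have : cyl A 0 w = Subtype.val ⁻¹' {x : ℕ → Fin ℓ | ∀ j : Fin (m + 1), x j = w j} := rfl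
    rw [measureReal_def, this, hpre, hcyl, ENNReal.toReal_ofReal]
    exact mul_nonneg (hπ0 _) (Finset.prod_nonneg fun _ _ => hQ0 _ _)

/-- Splitting a cylinder of the shifted point according to the first symbol. -/
theorem sum_real_prefixWord_cons {μ : Measure (SFT A)} (hμ : IsFiniteMeasure μ) (n : ℕ)
    (w : Fin n → Fin ℓ) :
    ∑ i, μ.real (prefixWord (n + 1) ⁻¹' {(Fin.cons i w : Fin (n + 1) → Fin ℓ)}) =
      μ.real (shift ⁻¹' (prefixWord n ⁻¹' {w})) := by
  rw [← sum_real_inter_preimage (measurable_coord 0)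
    (measurable_shift (measurable_prefixWord n (measurableSet_singleton w)))]
  refine Finset.sum_congr rfl fun i _ => congrArg μ.real ?_
  ext x
  simp only [Set.mem_preimage, Set.mem_singleton_iff, Set.mem_inter_iff, funext_iff,
    Fin.forall_fin_succ, prefixWord, Fin.cons_zero, Fin.cons_succ, shift, Fin.val_zero,
    Fin.val_succ]
  exact and_comm

/-- Stationarity of the initial law makes a Markov measure shift invariant. -/
theorem IsMarkovMeasure.isInvariantProb {μ : Measure (SFT A)} {π : Fin ℓ → ℝ}
    {Q : Matrix (Fin ℓ) (Fin ℓ) ℝ} (h : IsMarkovMeasure μ π Q) (hμ : IsProbabilityMeasure μ) :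
    IsInvariantProb shift μ := by
  refine ⟨hμ, measurable_shift, ?_⟩
  have := Measure.isProbabilityMeasure_map (μ := μ) (measurable_shift (A := A)).aemeasurable
  refine Measure.ext_of_prefixWord fun n w => ?_
  rw [map_measureReal_apply measurable_shift
    (measurable_prefixWord n (measurableSet_singleton w)), ← sum_real_prefixWord_cons inferInstance]
  rcases n with _ | m
  · have h1 : ∀ i, μ.real (prefixWord (0 + 1) ⁻¹' {(Fin.cons i w : Fin (0 + 1) → Fin ℓ)}) = π i :=
      fun i => by rw [preimage_prefixWord_eq_cyl, h.measure_cyl]; simp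
    have h2 : (prefixWord 0 ⁻¹' {w} : Set (SFT A)) = Set.univ := by
      ext x; simp [Subsingleton.elim _ w]
    rw [Finset.sum_congr rfl fun i _ => h1 i, h.init_sum, h2]; simp
  · have h1 : ∀ i, μ.real (prefixWord (m + 1 + 1) ⁻¹' {(Fin.cons i w : Fin (m + 1 + 1) → Fin ℓ)}) =
        (π i * Q i (w 0)) * ∏ r : Fin m, Q (w r.castSucc) (w r.succ) := fun i => by
      rw [preimage_prefixWord_eq_cyl, h.measure_cyl, Fin.prod_univ_succ]
      simp only [Fin.cons_zero, Fin.castSucc_zero, Fin.cons_succ, ← Fin.succ_castSucc, mul_assoc]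
    rw [Finset.sum_congr rfl fun i _ => h1 i, ← Finset.sum_mul, preimage_prefixWord_eq_cyl,
      h.measure_cyl]
    congr 1
    exact congrFun h.stationary (w 0)

end Markov

/-! ### The stationary vector and the reversed chain -/

theorem exπ_two (p q : ℝ) : exπ p q 2 =
    (1 - Real.exp (p + q)) / ((1 + Real.exp p) * (1 + Real.exp q)) := by
  have := Real.exp_pos p
  have := Real.exp_pos q
  simp only [exπ, Matrix.cons_val, Real.exp_add]
  field_simp
  ring

theorem exπ_pos {p q : ℝ} (hpq : Real.exp p + Real.exp q < 1) (i : Fin 3) : 0 < exπ p q i := by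
  have hp := Real.exp_pos p
  have hq := Real.exp_pos q
  obtain rfl | rfl | rfl : i = 0 ∨ i = 1 ∨ i = 2 := by revert i; decide
  · simp only [exπ, Matrix.cons_val]; positivity
  · simp only [exπ, Matrix.cons_val]; positivity
  · rw [exπ_two, Real.exp_add]
    refine div_pos ?_ (by positivity)
    nlinarith

theorem exπ_sum (p q : ℝ) : ∑ i, exπ p q i = 1 := by
  simp only [exπ, Fin.sum_univ_three, Matrix.cons_val]; ring

/-- Since each of the first two columns of `P` is constant off the diagonal, stationarity of a
probability vector is decided by its first two entries. -/
theorem eq_exπ_of_vecMul_eq {p q : ℝ} {a : Fin 3 → ℝ} (ha : ∑ i, a i = 1)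
    (h : Matrix.vecMul a (exP p q) = a) : a = exπ p q := by
  have hp := Real.exp_pos p
  have hq := Real.exp_pos q
  rw [Fin.sum_univ_three] at ha
  have h0 := congrFun h 0
  have h1 := congrFun h 1
  simp only [Matrix.vecMul, dotProduct, Fin.sum_univ_three, exP, Matrix.of_apply,
    Matrix.cons_val] at h0 h1
  have e0 : a 0 = Real.exp p / (1 + Real.exp p) := by
    rw [eq_div_iff (by positivity)]; linear_combination (-1 : ℝ) * h0 + Real.exp p * ha
  have e1 : a 1 = Real.exp q / (1 + Real.exp q) := by
    rw [eq_div_iff (by positivity)]; linear_combination (-1 : ℝ) * h1 + Real.exp q * ha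
  funext i
  obtain rfl | rfl | rfl : i = 0 ∨ i = 1 ∨ i = 2 := by revert i; decide
  · simpa [exπ] using e0
  · simpa [exπ] using e1
  · simp only [exπ, Matrix.cons_val, ← e0, ← e1]; linarith

theorem exπ_vecMul (p q : ℝ) : Matrix.vecMul (exπ p q) (exP p q) = exπ p q := by
  have hp := Real.exp_pos p
  have hq := Real.exp_pos q
  funext i
  obtain rfl | rfl | rfl : i = 0 ∨ i = 1 ∨ i = 2 := by revert i; decide
  all_goals
    simp only [Matrix.vecMul, dotProduct, Fin.sum_univ_three, exP, exπ, Matrix.of_apply,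
      Matrix.cons_val]
    field_simp
    ring

theorem exQ_nonneg {p q : ℝ} (hpq : Real.exp p + Real.exp q < 1) (i j : Fin 3) :
    0 ≤ exQ p q i j :=
  div_nonneg (mul_nonneg (exπ_pos hpq j).le (exP_nonneg hpq j i)) (exπ_pos hpq i).le

theorem exπ_mul_exQ {p q : ℝ} (hpq : Real.exp p + Real.exp q < 1) (i j : Fin 3) :
    exπ p q i * exQ p q i j = exπ p q j * exP p q j i :=
  mul_div_cancel₀ _ (exπ_pos hpq i).ne'

theorem exQ_row_sum {p q : ℝ} (hpq : Real.exp p + Real.exp q < 1) (i : Fin 3) :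
    ∑ j, exQ p q i j = 1 := by
  have h : ∑ j, exπ p q j * exP p q j i = exπ p q i := congrFun (exπ_vecMul p q) i
  have h0 := (exπ_pos hpq i).ne'
  refine mul_left_cancel₀ h0 ?_
  rw [Finset.mul_sum, mul_one]
  exact (Finset.sum_congr rfl fun j _ => exπ_mul_exQ hpq i j).trans h

theorem exπ_vecMul_exQ {p q : ℝ} (hpq : Real.exp p + Real.exp q < 1) :
    Matrix.vecMul (exπ p q) (exQ p q) = exπ p q := by
  funext j
  change ∑ i, exπ p q i * exQ p q i j = _
  rw [Finset.sum_congr rfl fun i _ => exπ_mul_exQ hpq i j, ← Finset.mul_sum, exP_row_sum, mul_one]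

/-- The cylinder formulas in terms of the forward and of the backward transition matrix agree. -/
theorem exπ_mul_prod_exQ {p q : ℝ} (hpq : Real.exp p + Real.exp q < 1) (m : ℕ)
    (w : Fin (m + 1) → Fin 3) :
    exπ p q (w 0) * ∏ r : Fin m, exQ p q (w r.castSucc) (w r.succ) =
      exπ p q (w (Fin.last m)) * ∏ r : Fin m, exP p q (w r.succ) (w r.castSucc) := by
  induction m with
  | zero => simp
  | succ m ih =>
    have := ih fun i => w i.succ
    rw [Fin.prod_univ_succ, Fin.prod_univ_succ, ← mul_assoc, Fin.castSucc_zero, exπ_mul_exQ hpq,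
      mul_right_comm]
    simp only [Fin.succ_castSucc, Fin.succ_zero_eq_one, Fin.succ_last] at this ⊢
    rw [this]; ring

/-! ### Equilibrium states -/

section Equilibrium

variable {p q : ℝ} {φ : SFT exA → ℝ}

/-- The cylinder probabilities of the Markov measure whose matrix of backward transition
probabilities is `P`. -/
def HasBackwardLaw (p q : ℝ) (μ : Measure (SFT exA)) : Prop :=
  ∀ (m : ℕ) (w : Fin (m + 1) → Fin 3), μ.real (prefixWord (m + 1) ⁻¹' {w}) =
    exπ p q (w (Fin.last m)) * ∏ r : Fin m, exP p q (w r.succ) (w r.castSucc)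

theorem integral_comp_eq_sum {X ι : Type*} [MeasurableSpace X] [Fintype ι] [MeasurableSpace ι]
    [MeasurableSingletonClass ι] (μ : Measure X) [IsFiniteMeasure μ] {ξ : X → ι}
    (hξ : Measurable ξ) (f : ι → ℝ) :
    ∫ x, f (ξ x) ∂μ = ∑ i, μ.real (ξ ⁻¹' {i}) * f i := by
  have hf : Measurable f := measurable_of_finite f
  rw [← integral_map hξ.aemeasurable hf.aestronglyMeasurable, integral_fintype .of_finite]
  simp only [map_measureReal_apply hξ (measurableSet_singleton _), smul_eq_mul]

theorem real_prefixWord_le_tail {m : Measure (SFT exA)} (hm : IsInvariantProb shift m) (n : ℕ)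
    (w : Fin (n + 1) → Fin 3) :
    m.real (prefixWord (n + 1) ⁻¹' {w}) ≤ m.real (prefixWord n ⁻¹' {Fin.tail w}) := by
  have := hm.1
  rw [← hm.2.measureReal_preimage
    (measurable_prefixWord n (measurableSet_singleton (Fin.tail w))).nullMeasurableSet]
  refine measureReal_mono ?_
  rintro x rfl
  rfl

theorem real_prefixWord_eq_zero (hpq : Real.exp p + Real.exp q < 1) (m : Measure (SFT exA))
    {n : ℕ} {w : Fin (n + 2) → Fin 3} (hw : exP p q (w 1) (w 0) = 0) :
    m.real (prefixWord (n + 2) ⁻¹' {w}) = 0 := by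
  have : (prefixWord (n + 2) ⁻¹' {w} : Set (SFT exA)) = ∅ := by
    refine Set.eq_empty_of_forall_notMem ?_
    rintro x rfl
    exact (exP_pos hpq (x.2 0)).ne' hw
  rw [this, measureReal_empty]

theorem real_prefixWord_eq_zero_of_mul (hpq : Real.exp p + Real.exp q < 1)
    {m : Measure (SFT exA)} (hm : IsInvariantProb shift m) {n : ℕ} {w : Fin (n + 2) → Fin 3}
    (hw : m.real (prefixWord (n + 1) ⁻¹' {Fin.tail w}) * exP p q (w 1) (w 0) = 0) :
    m.real (prefixWord (n + 2) ⁻¹' {w}) = 0 := by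
  rcases mul_eq_zero.1 hw with h | h
  · exact le_antisymm (h ▸ real_prefixWord_le_tail hm (n + 1) w) measureReal_nonneg
  · exact real_prefixWord_eq_zero hpq m h

theorem sum_real_prefixWord (m : Measure (SFT exA)) [IsProbabilityMeasure m] (n : ℕ) :
    ∑ w : Fin n → Fin 3, m.real (prefixWord n ⁻¹' {w}) = 1 := by
  simpa using sum_real_inter_preimage (μ := m) (measurable_prefixWord (A := exA) n)
    MeasurableSet.univ

/-- The entropy of `x₀` given `x₁, …, x_{n+1}` plus the mean of `φ` is minus the relative entropy
of the law of `x₀ … x_{n+1}` with respect to the law with the same `x₁ … x_{n+1}` and with `x₀`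
drawn from the row `x₁` of `P`. -/
theorem IsExPotential.increment_add_integral_eq (hφ : IsExPotential p q φ)
    {m : Measure (SFT exA)} (hm : IsInvariantProb shift m) (n : ℕ) :
    partitionEntropy m (prefixWord (n + 2) : SFT exA → _) -
        partitionEntropy m (prefixWord (n + 1) : SFT exA → _) + ∫ x, φ x ∂m =
      ∑ w : Fin (n + 2) → Fin 3, m.real (prefixWord (n + 2) ⁻¹' {w}) *
        (Real.log (m.real (prefixWord (n + 1) ⁻¹' {Fin.tail w}) * exP p q (w 1) (w 0)) -
          Real.log (m.real (prefixWord (n + 2) ⁻¹' {w}))) := by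
  have := hm.1
  have hint : ∫ x, φ x ∂m = ∑ w : Fin (n + 2) → Fin 3,
      m.real (prefixWord (n + 2) ⁻¹' {w}) * Real.log (exP p q (w 1) (w 0)) := by
    rw [← integral_comp_eq_sum m (measurable_prefixWord (n + 2))
      fun w => Real.log (exP p q (w 1) (w 0))]
    exact integral_congr_ae (ae_of_all _ fun x => hφ.apply_eq x)
  have hH : partitionEntropy m (prefixWord (n + 1) : SFT exA → _) =
      -∑ w : Fin (n + 2) → Fin 3, m.real (prefixWord (n + 2) ⁻¹' {w}) *
        Real.log (m.real (prefixWord (n + 1) ⁻¹' {Fin.tail w})) := by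
    have h1 := integral_comp_eq_sum m (measurable_prefixWord (A := exA) (n + 2))
      fun w => Real.log (m.real (prefixWord (n + 1) ⁻¹' {Fin.tail w}))
    have h2 := integral_comp_eq_sum m (measurable_prefixWord (A := exA) (n + 1))
      fun w => Real.log (m.real (prefixWord (n + 1) ⁻¹' {w}))
    have h3 := integral_map (μ := m) (measurable_shift (A := exA)).aemeasurable
      (f := fun x => Real.log (m.real (prefixWord (n + 1) ⁻¹' {prefixWord (n + 1) x})))
      (((measurable_of_finite fun w : Fin (n + 1) → Fin 3 =>
        Real.log (m.real (prefixWord (n + 1) ⁻¹' {w}))).comp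
          (measurable_prefixWord (n + 1))).aestronglyMeasurable)
    rw [hm.2.map_eq] at h3
    rw [← h1]
    refine Eq.trans ?_ (congrArg Neg.neg (h2.symm.trans h3))
    rw [partitionEntropy, ← Finset.sum_neg_distrib]
    exact Finset.sum_congr rfl fun w _ => by rw [Real.negMulLog, neg_mul]
  rw [hint, hH, partitionEntropy, sub_neg_eq_add, ← Finset.sum_add_distrib,
    ← Finset.sum_add_distrib]
  refine Finset.sum_congr rfl fun w _ => ?_
  rcases (measureReal_nonneg (μ := m) (s := prefixWord (n + 2) ⁻¹' {w})).eq_or_lt with h | h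
  · simp [← h]
  have h1 := h.trans_le (real_prefixWord_le_tail hm (n + 1) w)
  have h2 : exP p q (w 1) (w 0) ≠ 0 := fun h0 =>
    h.ne' (real_prefixWord_eq_zero hφ.exp_add_exp_lt_one m h0)
  rw [Real.log_mul h1.ne' h2, Real.negMulLog]
  ring

/-- The reference law in the relative entropy is a probability, since `P` is stochastic. -/
theorem sum_real_tail_mul_exP (p q : ℝ) (m : Measure (SFT exA)) [IsProbabilityMeasure m] (n : ℕ) :
    ∑ w : Fin (n + 2) → Fin 3,
      m.real (prefixWord (n + 1) ⁻¹' {Fin.tail w}) * exP p q (w 1) (w 0) = 1 := by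
  rw [← (Fin.consEquiv fun _ : Fin (n + 2) => Fin 3).sum_comp, Fintype.sum_prod_type_right,
    ← sum_real_prefixWord m (n + 1)]
  refine Finset.sum_congr rfl fun v _ => ?_
  change ∑ i, m.real (prefixWord (n + 1) ⁻¹' {v}) * exP p q (v 0) i = _
  rw [← Finset.mul_sum, exP_row_sum, mul_one]

theorem IsExPotential.increment_add_integral_nonpos (hφ : IsExPotential p q φ)
    {m : Measure (SFT exA)} (hm : IsInvariantProb shift m) (n : ℕ) :
    partitionEntropy m (prefixWord (n + 2) : SFT exA → _) -
        partitionEntropy m (prefixWord (n + 1) : SFT exA → _) + ∫ x, φ x ∂m ≤ 0 := by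
  have := hm.1
  have hpq := hφ.exp_add_exp_lt_one
  rw [hφ.increment_add_integral_eq hm]
  refine sum_mul_log_sub_log_le (fun _ => measureReal_nonneg)
    (fun w => mul_nonneg measureReal_nonneg (exP_nonneg hpq _ _))
    (fun _ => real_prefixWord_eq_zero_of_mul hpq hm) ?_
  rw [sum_real_tail_mul_exP, sum_real_prefixWord]

/-- The equality case: `x₀` is drawn from the row `x₁` of `P` independently of the later symbols. -/
theorem IsExPotential.real_prefixWord_eq_of_increment_nonneg (hφ : IsExPotential p q φ)
    {m : Measure (SFT exA)} (hm : IsInvariantProb shift m) (n : ℕ)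
    (h : 0 ≤ partitionEntropy m (prefixWord (n + 2) : SFT exA → _) -
        partitionEntropy m (prefixWord (n + 1) : SFT exA → _) + ∫ x, φ x ∂m)
    (w : Fin (n + 2) → Fin 3) : m.real (prefixWord (n + 2) ⁻¹' {w}) =
      m.real (prefixWord (n + 1) ⁻¹' {Fin.tail w}) * exP p q (w 1) (w 0) := by
  have := hm.1
  have hpq := hφ.exp_add_exp_lt_one
  rw [hφ.increment_add_integral_eq hm] at h
  refine eq_of_sum_mul_log_sub_log_nonneg (fun _ => measureReal_nonneg)
    (fun w => mul_nonneg measureReal_nonneg (exP_nonneg hpq _ _))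
    (fun _ => real_prefixWord_eq_zero_of_mul hpq hm) ?_ h w
  rw [sum_real_tail_mul_exP, sum_real_prefixWord]

theorem ksEntropy_add_integral_le_increment {m : Measure (SFT exA)}
    (hm : IsInvariantProb shift m) (φ : SFT exA → ℝ) (n : ℕ) :
    ksEntropy shift m + ((∫ x, φ x ∂m : ℝ) : EReal) ≤
      ((partitionEntropy m (prefixWord (n + 2) : SFT exA → _) -
        partitionEntropy m (prefixWord (n + 1) : SFT exA → _) + ∫ x, φ x ∂m : ℝ) : EReal) := by
  rw [EReal.coe_add]
  gcongr
  exact ksEntropy_le_increment hm (n + 1)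

theorem IsExPotential.ksEntropy_add_integral_nonpos (hφ : IsExPotential p q φ)
    {m : Measure (SFT exA)} (hm : IsInvariantProb shift m) :
    ksEntropy shift m + ((∫ x, φ x ∂m : ℝ) : EReal) ≤ 0 := by
  refine (ksEntropy_add_integral_le_increment hm φ 0).trans ?_
  exact_mod_cast hφ.increment_add_integral_nonpos hm 0

/-- An invariant probability of nonnegative free energy is the Markov measure with backward
transition matrix `P`. -/
theorem IsExPotential.hasBackwardLaw_of_nonneg (hφ : IsExPotential p q φ)
    {m : Measure (SFT exA)} (hm : IsInvariantProb shift m)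
    (h : 0 ≤ ksEntropy shift m + ((∫ x, φ x ∂m : ℝ) : EReal)) : HasBackwardLaw p q m := by
  intro n w
  have := hm.1
  have step := fun n => hφ.real_prefixWord_eq_of_increment_nonneg hm n
    (by exact_mod_cast h.trans (ksEntropy_add_integral_le_increment hm φ n))
  -- the one-dimensional law of `m`, which is stationary for `P`
  set a : Fin 3 → ℝ := fun i => m.real (prefixWord 1 ⁻¹' {fun _ => i}) with ha
  have hone : ∀ v : Fin 1 → Fin 3, m.real (prefixWord 1 ⁻¹' {v}) = a (v 0) := fun v => by
    rw [ha]; congr; funext i; rw [Subsingleton.elim i 0]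
  have hcoord : ∀ i, m.real ((fun x : SFT exA => x.1 0) ⁻¹' {i}) = a i := fun i => by
    rw [ha]; congr 1; ext x
    simp [prefixWord, funext_iff]
  have hsum : ∑ i, a i = 1 := by
    have := sum_real_inter_preimage (μ := m) (measurable_coord (A := exA) 0) MeasurableSet.univ
    simp only [Set.univ_inter, probReal_univ, hcoord] at this
    exact this
  have hstat : Matrix.vecMul a (exP p q) = a := by
    funext i
    have h1 := sum_real_inter_preimage (μ := m) (measurable_coord (A := exA) 1)
      (measurable_coord 0 (measurableSet_singleton i))
    rw [hcoord] at h1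
    rw [← h1]
    change ∑ j, a j * exP p q j i = _
    refine Finset.sum_congr rfl fun j _ => ?_
    have h2 := step 0 ![i, j]
    rw [hone] at h2
    refine h2.symm.trans (congrArg m.real ?_)
    ext x
    simp [prefixWord, funext_iff, Fin.forall_fin_succ]
  have hπ := eq_exπ_of_vecMul_eq hsum hstat
  induction n with
  | zero => rw [hone, hπ]; simp
  | succ n ih =>
    rw [step n w, ih (Fin.tail w), Fin.prod_univ_succ]
    simp only [Fin.tail, Fin.succ_castSucc, Fin.succ_last, Fin.castSucc_zero, Fin.succ_zero_eq_one]
    ring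

/-- A Markov measure whose backward transition matrix is `P` has free energy at least zero. -/
theorem IsExPotential.nonneg_of_hasBackwardLaw (hφ : IsExPotential p q φ)
    {m : Measure (SFT exA)} (hm : IsInvariantProb shift m)
    (h : HasBackwardLaw p q m) :
    0 ≤ ksEntropy shift m + ((∫ x, φ x ∂m : ℝ) : EReal) := by
  set H : ℕ → ℝ := fun n => partitionEntropy m (prefixWord n : SFT exA → _) with hH
  set I := ∫ x, φ x ∂m with hI
  have hinc : ∀ n, H (n + 2) - H (n + 1) + I = 0 := fun n => by
    rw [hφ.increment_add_integral_eq hm n]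
    refine Finset.sum_eq_zero fun w _ => ?_
    have : m.real (prefixWord (n + 2) ⁻¹' {w}) =
        m.real (prefixWord (n + 1) ⁻¹' {Fin.tail w}) * exP p q (w 1) (w 0) := by
      rw [h (n + 1), h n, Fin.prod_univ_succ]
      simp only [Fin.tail, Fin.succ_castSucc, Fin.succ_last, Fin.castSucc_zero,
        Fin.succ_zero_eq_one]
      ring
    rw [this, sub_self, mul_zero]
  have hHn : ∀ n : ℕ, H (n + 1) = H 1 - n * I := fun n => by
    induction n with
    | zero => simp
    | succ n ih => have := hinc n; push_cast; linarith
  have hlim : Tendsto (fun n : ℕ => H n / n) atTop (𝓝 (-I)) := by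
    have h1 : Tendsto (fun n : ℕ => (H 1 + I) / n - I) atTop (𝓝 (0 - I)) :=
      (tendsto_const_div_atTop_nhds_zero_nat _).sub_const I
    rw [zero_sub] at h1
    refine h1.congr' ?_
    filter_upwards [eventually_ge_atTop 1] with n hn
    obtain ⟨n, rfl⟩ := Nat.exists_eq_add_of_le' hn
    rw [hHn n]
    field_simp
    push_cast
    ring
  have hks : ((-I : ℝ) : EReal) ≤ ksEntropy shift m := by
    refine le_trans ?_ (le_iSup_of_le 3 (le_iSup_of_le ⟨fun x => x.1 0, measurable_coord 0⟩ le_rfl))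
    have hit : ∀ n, itinerary shift (fun x : SFT exA => x.1 0) n = prefixWord n := fun n => by
      funext x i; simp [itinerary, prefixWord, iterate_shift_apply]
    have := (continuous_coe_real_ereal.tendsto (-I)).comp hlim
    simp only [hit]
    exact this.limsup_eq.ge
  calc (0 : EReal) = ((-I : ℝ) : EReal) + ((I : ℝ) : EReal) := by
        rw [← EReal.coe_add, neg_add_cancel, EReal.coe_zero]
    _ ≤ _ := by gcongr

/-- The potential has pressure zero, and its only equilibrium state is the Markov measure with
backward transition matrix `P`. -/
theorem IsExPotential.exists_equilibrium (hφ : IsExPotential p q φ) :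
    ∃ μ : Measure (SFT exA), IsInvariantProb shift μ ∧ IsMarkovMeasure μ (exπ p q) (exQ p q) ∧
      pressure shift φ = 0 ∧ (∀ ν, IsEquilibriumState shift φ ν ↔ ν = μ) ∧
      HasBackwardLaw p q μ := by
  have hpq := hφ.exp_add_exp_lt_one
  obtain ⟨μ, hμ, hMarkov⟩ := exists_isMarkovMeasure (A := exA) (fun i => (exπ_pos hpq i).le)
    (exπ_sum p q) (exQ_nonneg hpq) (exQ_row_sum hpq) (exπ_vecMul_exQ hpq) fun i j h => by
      change exπ p q j * exP p q j i / exπ p q i = 0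
      rw [exP_eq_zero p q h, mul_zero, zero_div]
  have hinv := hMarkov.isInvariantProb hμ
  have hpre : HasBackwardLaw p q μ := fun m w => by
    rw [preimage_prefixWord_eq_cyl, hMarkov.measure_cyl, exπ_mul_prod_exQ hpq]
  have hzero : ksEntropy shift μ + ((∫ x, φ x ∂μ : ℝ) : EReal) = 0 :=
    le_antisymm (hφ.ksEntropy_add_integral_nonpos hinv)
      (hφ.nonneg_of_hasBackwardLaw hinv hpre)
  have hpress : pressure shift φ = 0 :=
    le_antisymm (iSup_le fun m => hφ.ksEntropy_add_integral_nonpos m.2)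
      (hzero.ge.trans (le_iSup_of_le (⟨μ, hinv⟩ : {m // IsInvariantProb shift m}) le_rfl))
  refine ⟨μ, hinv, hMarkov, hpress, fun ν => ⟨fun hν => ?_, ?_⟩, hpre⟩
  · have := hν.1.1
    have h := hφ.hasBackwardLaw_of_nonneg hν.1 (by rw [hν.2, hpress])
    refine Measure.ext_of_prefixWord fun n w => ?_
    rcases n with _ | n
    · have : (prefixWord 0 ⁻¹' {w} : Set (SFT exA)) = Set.univ := by
        ext x; simp [Subsingleton.elim _ w]
      rw [this, probReal_univ, probReal_univ]
    · rw [h, hpre]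
  · rintro rfl
    exact ⟨hinv, by rw [hzero, hpress]⟩

end Equilibrium

/-! ### Escape rates -/

section Escape

variable {p q : ℝ}

theorem survivors_succ_eq (n : ℕ) : survivors exA exΔ (n + 1) =
    prefixWord (n + 1) ⁻¹' {prefixWord (n + 1) pt12} ∪
      prefixWord (n + 1) ⁻¹' {prefixWord (n + 1) pt21} := by
  ext x
  simp only [Set.mem_union, Set.mem_preimage, Set.mem_singleton_iff, prefixWord_eq_iff]
  constructor
  · intro hx
    have h0 : x.1 0 = 0 ∨ x.1 0 = 1 := by simpa [exΔ] using hx 0 (by omega)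
    exact h0.imp (agree_of_mem_survivors hx pt12_mem) (agree_of_mem_survivors hx pt21_mem)
  · rintro (h | h) k hk
    · exact h k hk ▸ pt12_mem k
    · exact h k hk ▸ pt21_mem k

variable {μ : Measure (SFT exA)}

/-- Prepending a symbol to an alternating word multiplies the measure by `e^p` or `e^q`. -/
theorem real_prefixWord_alternating (hμ : HasBackwardLaw p q μ) (n : ℕ) :
    μ.real (prefixWord (n + 2) ⁻¹' {prefixWord (n + 2) pt12}) =
      Real.exp p * μ.real (prefixWord (n + 1) ⁻¹' {prefixWord (n + 1) pt21}) ∧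
    μ.real (prefixWord (n + 2) ⁻¹' {prefixWord (n + 2) pt21}) =
      Real.exp q * μ.real (prefixWord (n + 1) ⁻¹' {prefixWord (n + 1) pt12}) := by
  have step : ∀ z : SFT exA, μ.real (prefixWord (n + 2) ⁻¹' {prefixWord (n + 2) z}) =
      exP p q (z.1 1) (z.1 0) *
        μ.real (prefixWord (n + 1) ⁻¹' {prefixWord (n + 1) (shift z)}) := fun z => by
    rw [hμ (n + 1), hμ n, Fin.prod_univ_succ]
    have e : ∀ i : Fin (n + 1), prefixWord (n + 1) (shift z) i = prefixWord (n + 2) z i.succ :=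
      fun i => rfl
    simp only [e, Fin.succ_castSucc, Fin.succ_last]
    change _ * (exP p q (z.1 1) (z.1 0) * _) = _
    ring
  rw [step, step, shift_pt12, shift_pt21]
  constructor <;> congr 1

theorem real_prefixWord_one (hμ : HasBackwardLaw p q μ) (z : SFT exA) :
    μ.real (prefixWord 1 ⁻¹' {prefixWord 1 z}) = exπ p q (z.1 0) := by
  rw [hμ 0]; simp [prefixWord]

theorem real_survivors [IsProbabilityMeasure μ] (hμ : HasBackwardLaw p q μ) (n : ℕ) :
    μ.real (survivors exA exΔ (2 * n + 1)) =
      Real.exp (n * (p + q)) * (exπ p q 0 + exπ p q 1) ∧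
    μ.real (survivors exA exΔ (2 * n + 2)) =
      Real.exp (n * (p + q)) * (Real.exp p * exπ p q 1 + Real.exp q * exπ p q 0) := by
  have hsurv : ∀ n, μ.real (survivors exA exΔ (n + 1)) =
      μ.real (prefixWord (n + 1) ⁻¹' {prefixWord (n + 1) pt12}) +
        μ.real (prefixWord (n + 1) ⁻¹' {prefixWord (n + 1) pt21}) := fun n => by
    rw [survivors_succ_eq, measureReal_union _
      (measurable_prefixWord _ (measurableSet_singleton _))]
    refine Set.disjoint_left.2 fun x hx hx' => ?_
    have := congrFun (hx.symm.trans hx') 0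
    simp [prefixWord, pt12, pt21] at this
  have halt : ∀ n : ℕ, μ.real (prefixWord (2 * n + 1) ⁻¹' {prefixWord (2 * n + 1) pt12}) =
        Real.exp (n * (p + q)) * exπ p q 0 ∧
      μ.real (prefixWord (2 * n + 1) ⁻¹' {prefixWord (2 * n + 1) pt21}) =
        Real.exp (n * (p + q)) * exπ p q 1 := fun n => by
    induction n with
    | zero =>
      have h0 := real_prefixWord_one hμ pt12
      have h1 := real_prefixWord_one hμ pt21
      simp only [Nat.cast_zero, zero_mul, Real.exp_zero, one_mul]
      exact ⟨h0, h1⟩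
    | succ n ih =>
      have hexp : Real.exp ((n + 1 : ℕ) * (p + q)) =
          Real.exp p * Real.exp q * Real.exp (n * (p + q)) := by
        rw [← Real.exp_add, ← Real.exp_add]; push_cast; ring_nf
      have h1 := real_prefixWord_alternating hμ (2 * n)
      have h2 := real_prefixWord_alternating hμ (2 * n + 1)
      rw [h1.1, h1.2, ih.1, ih.2] at h2
      rw [hexp]
      exact ⟨h2.1.trans (by ring), h2.2.trans (by ring)⟩
  have h1 := real_prefixWord_alternating hμ (2 * n)
  rw [(halt n).1, (halt n).2] at h1
  exact ⟨by rw [hsurv, (halt n).1, (halt n).2]; ring, by rw [hsurv, h1.1, h1.2]; ring⟩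

theorem integral_exh [IsProbabilityMeasure μ] (hμ : HasBackwardLaw p q μ) :
    ∫ x, exh0 x ∂μ = 1 / (1 + Real.exp q) ∧ ∫ x, exh1 x ∂μ = 1 / (1 + Real.exp p) ∧
      ∫ x, (exh0 x + exh1 x) ∂μ = 1 / (1 + Real.exp q) + 1 / (1 + Real.exp p) := by
  have hcoord : ∀ i, μ.real ((fun x : SFT exA => x.1 0) ⁻¹' {i}) = exπ p q i := fun i => by
    have h := hμ 0 fun _ => i
    simp only [Finset.univ_eq_empty, Finset.prod_empty, mul_one] at h
    rw [← h]; congr 1; ext x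
    simp [prefixWord, funext_iff]
  have hint := fun f => integral_comp_eq_sum μ (measurable_coord (A := exA) 0) f
  have hp := Real.exp_pos p
  have hq := Real.exp_pos q
  simp only [exh0_eq_ite, exh1_eq_ite]
  refine ⟨(hint fun i => if i = 1 then 0 else 1).trans ?_,
    (hint fun i => if i = 0 then 0 else 1).trans ?_,
    (hint fun i => (if i = 1 then 0 else 1) + (if i = 0 then 0 else 1)).trans ?_⟩
  all_goals
    simp [Fin.sum_univ_three, hcoord, exπ]
    field_simp
    ring

theorem tendsto_real_survivors_even [IsProbabilityMeasure μ] (hμ : HasBackwardLaw p q μ) :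
    Tendsto (fun n : ℕ => Real.exp (-((2 * n : ℕ) * ((p + q) / 2))) *
      μ.real (survivors exA exΔ (2 * n))) atTop
        (𝓝 (1 / (1 + Real.exp q) + 1 / (1 + Real.exp p))) := by
  refine tendsto_const_nhds.congr' ?_
  filter_upwards [eventually_ge_atTop 1] with n hn
  obtain ⟨n, rfl⟩ := Nat.exists_eq_add_of_le' hn
  have e : Real.exp (-((2 * n + 2 : ℕ) * ((p + q) / 2))) =
      (Real.exp (n * (p + q)) * (Real.exp p * Real.exp q))⁻¹ := by
    rw [← Real.exp_add, ← Real.exp_add, ← Real.exp_neg]; push_cast; ring_nf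
  rw [mul_add, mul_one, e, (real_survivors hμ n).2]
  have hp := Real.exp_pos p
  have hq := Real.exp_pos q
  simp only [exπ, Matrix.cons_val]
  field_simp

theorem tendsto_real_survivors_odd [IsProbabilityMeasure μ] (hμ : HasBackwardLaw p q μ) :
    Tendsto (fun n : ℕ => Real.exp (-((2 * n + 1 : ℕ) * ((p + q) / 2))) *
      μ.real (survivors exA exΔ (2 * n + 1))) atTop
        (𝓝 (Real.exp ((q - p) / 2) * (1 / (1 + Real.exp q)) +
          Real.exp ((p - q) / 2) * (1 / (1 + Real.exp p)))) := by
  refine tendsto_const_nhds.congr' (Eventually.of_forall fun n => ?_)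
  have e1 : Real.exp ((q - p) / 2) = Real.exp (-((2 * n + 1 : ℕ) * ((p + q) / 2))) *
      Real.exp (n * (p + q)) * Real.exp q := by
    rw [← Real.exp_add, ← Real.exp_add]; push_cast; ring_nf
  have e2 : Real.exp ((p - q) / 2) = Real.exp (-((2 * n + 1 : ℕ) * ((p + q) / 2))) *
      Real.exp (n * (p + q)) * Real.exp p := by
    rw [← Real.exp_add, ← Real.exp_add]; push_cast; ring_nf
  dsimp only
  rw [(real_survivors hμ n).1, e1, e2]
  simp only [exπ, Matrix.cons_val]
  ring

/-- With `u = e^{p/2}`, `v = e^{q/2}` the two limits differ by a positive multiple of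
`(u - v)² (1 - 1 / (u v))`, and `u v < 1`. -/
theorem limits_eq_iff (hpq : Real.exp p + Real.exp q < 1) :
    1 / (1 + Real.exp q) + 1 / (1 + Real.exp p) =
      Real.exp ((q - p) / 2) * (1 / (1 + Real.exp q)) +
        Real.exp ((p - q) / 2) * (1 / (1 + Real.exp p)) ↔ p = q := by
  constructor
  · intro h
    set u := Real.exp (p / 2) with hu
    set v := Real.exp (q / 2) with hv
    have hu0 : 0 < u := Real.exp_pos _
    have hv0 : 0 < v := Real.exp_pos _
    have ep : Real.exp p = u * u := by rw [hu, ← Real.exp_add]; ring_nf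
    have eq : Real.exp q = v * v := by rw [hv, ← Real.exp_add]; ring_nf
    have e1 : Real.exp ((q - p) / 2) = v / u := by rw [hu, hv, ← Real.exp_sub]; ring_nf
    have e2 : Real.exp ((p - q) / 2) = u / v := by rw [hu, hv, ← Real.exp_sub]; ring_nf
    rw [ep, eq, e1, e2] at h
    rw [ep, eq] at hpq
    field_simp at h
    have h2 : (u - v) ^ 2 * (1 - u * v) = 0 := by linear_combination -h
    have h3 : 1 - u * v ≠ 0 := by nlinarith [sq_nonneg (u - v)]
    have h4 : u = v := by
      have := (mul_eq_zero.1 h2).resolve_right h3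
      exact sub_eq_zero.1 (pow_eq_zero_iff two_ne_zero |>.1 this)
    have := Real.exp_injective h4
    linarith
  · rintro rfl
    simp

theorem tendsto_of_tendsto_even_odd {u : ℕ → ℝ} {l : ℝ}
    (h0 : Tendsto (fun n => u (2 * n)) atTop (𝓝 l))
    (h1 : Tendsto (fun n => u (2 * n + 1)) atTop (𝓝 l)) : Tendsto u atTop (𝓝 l) := by
  rw [Metric.tendsto_atTop] at *
  intro ε hε
  obtain ⟨N, hN⟩ := h0 ε hε
  obtain ⟨M, hM⟩ := h1 ε hε
  refine ⟨2 * N + 2 * M + 1, fun n hn => ?_⟩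
  rcases Nat.even_or_odd' n with ⟨k, rfl | rfl⟩
  · exact hN k (by omega)
  · exact hM k (by omega)

end Escape

end

theorem mainTheorem3 (p q : ℝ) :
    -- the ambient system is irreducible and aperiodic, the subsystem irreducible of period 2
    exA.IsPrimitive ∧ exAΔ.IsIrreducible ∧ (∀ (i : exΔ) (n : ℕ), 0 < (exAΔ ^ n) i i ↔ Even n) ∧
    subsystem exA exΔ = {pt12, pt21} ∧ shift pt12 = pt21 ∧ shift pt21 = pt12 ∧
    -- for which `p`, `q` the potential exists, and its uniqueness
    ((∃ φ, IsExPotential p q φ) ↔ Real.exp p + Real.exp q < 1) ∧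
    (∀ φ₁ φ₂, IsExPotential p q φ₁ → IsExPotential p q φ₂ → φ₁ = φ₂) ∧
    ∀ φ : SFT exA → ℝ, IsExPotential p q φ →
      -- values on `C[31]`, `C[32]`, `C[33]`
      (∀ x : SFT exA, x.1 0 = 2 → x.1 1 = 0 → φ x = Real.log (1 - Real.exp q)) ∧
      (∀ x : SFT exA, x.1 0 = 2 → x.1 1 = 1 → φ x = Real.log (1 - Real.exp p)) ∧
      (∀ x : SFT exA, x.1 0 = 2 → x.1 1 = 2 → φ x = Real.log (1 - Real.exp p - Real.exp q)) ∧
      -- the subsystem has one invariant probability; the pressures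
      (∀ m : Measure (subsystem exA exΔ), IsInvariantProb (subShift exA exΔ) m ↔
        m = (2 : ENNReal)⁻¹ •
          (Measure.dirac ⟨pt12, pt12_mem⟩ + Measure.dirac ⟨pt21, pt21_mem⟩)) ∧
      pressure shift φ = 0 ∧
      subPressure φ exΔ = (((p + q) / 2 : ℝ) : EReal) ∧
      -- the functions `h₀`, `h₁` and the constants `d₀ = e^p`, `d₁ = e^q`
      (∀ x, Tendsto (fun n : ℕ => Real.exp (-(2 * n * exPress φ)) *
        ((transferWord φ 0 1)^[n] (fun _ => 1)) x) atTop (𝓝 (exh0 x))) ∧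
      (∀ x, Tendsto (fun n : ℕ => Real.exp (-(2 * n * exPress φ)) *
        ((transferWord φ 1 0)^[n] (fun _ => 1)) x) atTop (𝓝 (exh1 x))) ∧
      transferRestr φ exΔ (fun _ => (1 : ℝ)) pt21 = Real.exp p ∧
      transferRestr φ exΔ (fun _ => (1 : ℝ)) pt12 = Real.exp q ∧
      transferRestr φ exΔ exh0 = Real.exp p • exh1 ∧
      transferRestr φ exΔ exh1 = Real.exp q • exh0 ∧
      -- asymptotics of the iterates of the restricted transfer operator
      (∀ ψ : C(SFT exA, ℂ),
        TendstoUniformly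
          (fun (n : ℕ) x => Real.exp (-((2 * n : ℕ) * exPress φ)) •
            ((transferRestr φ exΔ)^[2 * n] ψ) x)
          (fun x => exh0 x • ψ pt12 + exh1 x • ψ pt21) atTop ∧
        TendstoUniformly
          (fun (n : ℕ) x => Real.exp (-((2 * n + 1 : ℕ) * exPress φ)) •
            ((transferRestr φ exΔ)^[2 * n + 1] ψ) x)
          (fun x => Real.exp ((p - q) / 2) • exh1 x • ψ pt12 +
            Real.exp ((q - p) / 2) • exh0 x • ψ pt21) atTop) ∧
      -- the equilibrium state
      (∀ i, 0 < exπ p q i) ∧ (∀ i j, 0 ≤ exP p q i j) ∧ (∀ i, ∑ j, exP p q i j = 1) ∧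
      Matrix.vecMul (exπ p q) (exP p q) = exπ p q ∧
      ∃ μ : Measure (SFT exA), (∀ ν, IsEquilibriumState shift φ ν ↔ ν = μ) ∧
        (∀ (k m : ℕ) (w : Fin (m + 1) → Fin 3), μ.real (cyl exA k w) =
          exπ p q (w (Fin.last m)) * ∏ r : Fin m, exP p q (w r.succ) (w r.castSucc)) ∧
        IsMarkovMeasure μ (exπ p q) (exQ p q) ∧
        -- the limits along even and odd `n`
        (∫ x, (exh0 x + exh1 x) ∂μ) =
          (2 + Real.exp p + Real.exp q) / ((1 + Real.exp p) * (1 + Real.exp q)) ∧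
        Real.exp ((q - p) / 2) * ∫ x, exh0 x ∂μ + Real.exp ((p - q) / 2) * ∫ x, exh1 x ∂μ =
          (Real.exp ((q - p) / 2) * (1 + Real.exp p) + Real.exp ((p - q) / 2) * (1 + Real.exp q)) /
            ((1 + Real.exp p) * (1 + Real.exp q)) ∧
        Tendsto (fun n : ℕ => Real.exp (-((2 * n : ℕ) * exPress φ)) *
            μ.real (survivors exA exΔ (2 * n))) atTop
          (𝓝 (∫ x, (exh0 x + exh1 x) ∂μ)) ∧
        Tendsto (fun n : ℕ => Real.exp (-((2 * n + 1 : ℕ) * exPress φ)) *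
            μ.real (survivors exA exΔ (2 * n + 1))) atTop
          (𝓝 (Real.exp ((q - p) / 2) * ∫ x, exh0 x ∂μ +
            Real.exp ((p - q) / 2) * ∫ x, exh1 x ∂μ)) ∧
        ((∫ x, (exh0 x + exh1 x) ∂μ) = Real.exp ((q - p) / 2) * ∫ x, exh0 x ∂μ +
            Real.exp ((p - q) / 2) * ∫ x, exh1 x ∂μ ↔ p = q) ∧
        ((∃ l : ℝ, Tendsto (fun n : ℕ => Real.exp (-(n * exPress φ)) *
            μ.real (survivors exA exΔ n)) atTop (𝓝 l)) ↔ p = q) := by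
  refine ⟨exA_isPrimitive, exAΔ_isIrreducible, exAΔ_pow_apply_self_pos_iff, subsystem_eq,
    shift_pt12, shift_pt21, exists_isExPotential_iff, fun φ₁ φ₂ h₁ h₂ => h₁.unique h₂,
    fun φ hφ => ?_⟩
  have hpq := hφ.exp_add_exp_lt_one
  obtain ⟨μ, hinv, hMarkov, hpress, hunique, hlaw⟩ := hφ.exists_equilibrium
  have := hinv.1
  obtain ⟨hi0, hi1, hi01⟩ := integral_exh hlaw
  have hcyl : ∀ (k m : ℕ) (w : Fin (m + 1) → Fin 3), μ.real (cyl exA k w) =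
      exπ p q (w (Fin.last m)) * ∏ r : Fin m, exP p q (w r.succ) (w r.castSucc) := fun k m w => by
    have hmeas : MeasurableSet (cyl exA 0 w) := by
      rw [← preimage_prefixWord_eq_cyl]
      exact measurable_prefixWord _ (measurableSet_singleton w)
    rw [cyl_eq_preimage_iterate_shift, (hinv.2.iterate k).measureReal_preimage
      hmeas.nullMeasurableSet, ← preimage_prefixWord_eq_cyl, hlaw]
  have heven := tendsto_real_survivors_even hlaw
  have hodd := tendsto_real_survivors_odd hlaw
  have hp := Real.exp_pos p
  have hq := Real.exp_pos q
  rw [hφ.exPress_eq]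
  refine ⟨fun x h0 h1 => ?_, fun x h0 h1 => ?_, fun x h0 h1 => ?_, isInvariantProb_subShift_iff,
    hpress, hφ.subPressure_eq, hφ.tendsto_transferWord_zero_one, hφ.tendsto_transferWord_one_zero,
    ?_, ?_, hφ.transferRestr_exh0, hφ.transferRestr_exh1,
    fun ψ => ⟨hφ.tendstoUniformly_even ψ.continuous, hφ.tendstoUniformly_odd ψ.continuous⟩,
    exπ_pos hpq, exP_nonneg hpq, exP_row_sum p q, exπ_vecMul p q,
    μ, hunique, hcyl, hMarkov, ?_, ?_, ?_, ?_, ?_, ?_⟩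
  · rw [hφ.apply_eq, h0, h1]; simp [exP]
  · rw [hφ.apply_eq, h0, h1]; simp [exP]
  · rw [hφ.apply_eq, h0, h1]; simp [exP]
  · rw [hφ.transferRestr_apply]; simp [exh0_eq_ite, exh1_eq_ite, pt21]
  · rw [hφ.transferRestr_apply]; simp [exh0_eq_ite, exh1_eq_ite, pt12]
  · rw [hi01]; field_simp; ring
  · rw [hi0, hi1]; field_simp
  · rw [hi01]; exact heven
  · rw [hi0, hi1]; exact hodd
  · rw [hi01, hi0, hi1]; exact limits_eq_iff hpq
  · constructor
    · rintro ⟨l, hl⟩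
      have h2 : Tendsto (fun n : ℕ => 2 * n) atTop atTop :=
        tendsto_atTop_mono (fun n => by simp only [id]; omega) tendsto_id
      have h3 : Tendsto (fun n : ℕ => 2 * n + 1) atTop atTop :=
        tendsto_atTop_mono (fun n => Nat.le_succ _) h2
      exact (limits_eq_iff hpq).1 ((tendsto_nhds_unique heven (hl.comp h2)).trans
        (tendsto_nhds_unique hodd (hl.comp h3)).symm)
    · intro h
      rw [← (limits_eq_iff hpq).2 h] at hodd
      exact ⟨_, tendsto_of_tendsto_even_odd heven hodd⟩
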